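/- Let $P\subset\mathbb{R}^n$ be a convex polytope (the convex hull of a finite set of points), regarded as a cell complex whose cells are all its nonempty faces, $P$ itself included. Let $k\ge 1$ and let $P_j$ denote the $j$-skeleton of $P$, i.e. the subcomplex of all faces of dimension at most $j$. For a cell complex $\Sigma$ write $f_j(\Sigma)$ for its number of $j$-dimensional faces, $\tilde H_j(\Sigma;\mathbb{Z})$ for the reduced singular homology of its underlying space, and $\beta_j(\Sigma)=\operatorname{rank}\tilde H_j(\Sigma;\mathbb{Z})$. A $k$-dimensional spanning tree of $P_k$ is a subcomplex $T\subseteq P_k$ with $T_{k-1}=P_{k-1}$ such that $$\tilde H_k(T;\mathbb{Z})=0,\qquad |\tilde H_{k-1}(T;\mathbb{Z})|<\infty,\qquad f_k(T)=f_k(P_k)-\beta_k(P_k).$$ If $T$ is a $k$-dimensional spanning tree of $P_k$, then $$f_k(T)=\beta_{k-1}(P_{k-1}).$$ -/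

import Mathlib

/-- A convex polytope in `ℝⁿ`: the convex hull of finitely many points. -/
def IsConvexPolytope {n : ℕ} (P : Set (EuclideanSpace ℝ (Fin n))) : Prop :=
  ∃ S : Finset (EuclideanSpace ℝ (Fin n)), P = convexHull ℝ (S : Set (EuclideanSpace ℝ (Fin n)))

/-- `F` is a (nonempty) face of `P`: the set of points of `P` at which some linear functional
attains its maximum on `P`. The zero functional gives the face `P` itself. -/
def IsFace {n : ℕ} (P F : Set (EuclideanSpace ℝ (Fin n))) : Prop :=
  F.Nonempty ∧ IsExposed ℝ P F

/-- The dimension of a face: the dimension of its affine hull. -/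
noncomputable def faceDim {n : ℕ} (F : Set (EuclideanSpace ℝ (Fin n))) : ℕ :=
  Module.finrank ℝ (vectorSpan ℝ F)

/-- The cell complex of all faces of `P`, with `P` itself included. Cell complexes in `ℝⁿ` are
represented by their sets of (closed) cells. -/
def faceComplex {n : ℕ} (P : Set (EuclideanSpace ℝ (Fin n))) :
    Set (Set (EuclideanSpace ℝ (Fin n))) :=
  {F | IsFace P F}

/-- The `k`-skeleton `Σ_k`: all faces of dimension at most `k`. -/
def skeleton {n : ℕ} (Sig : Set (Set (EuclideanSpace ℝ (Fin n)))) (k : ℕ) :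
    Set (Set (EuclideanSpace ℝ (Fin n))) :=
  {F | F ∈ Sig ∧ faceDim F ≤ k}

/-- The number `f_l(Σ)` of `l`-dimensional faces. -/
noncomputable def faceCount {n : ℕ} (Sig : Set (Set (EuclideanSpace ℝ (Fin n)))) (l : ℕ) : ℕ :=
  Set.ncard {F | F ∈ Sig ∧ faceDim F = l}

/-- `T` is a subcomplex of `Σ`: a set of cells of `Σ` closed under passing to faces. -/
def IsSubcomplex {n : ℕ} (T Sig : Set (Set (EuclideanSpace ℝ (Fin n)))) : Prop :=
  T ⊆ Sig ∧ ∀ F ∈ T, ∀ G, IsFace F G → G ∈ T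

/-- The underlying topological space of a complex: the union of its cells, with the topology
induced from `ℝⁿ`. -/
def realization {n : ℕ} (Sig : Set (Set (EuclideanSpace ℝ (Fin n)))) : TopCat.{0} :=
  TopCat.of (⋃₀ Sig : Set (EuclideanSpace ℝ (Fin n)))

/-- The functor `H_i(-; ℤ)`: singular homology with integer coefficients. -/
noncomputable def integralHomology (i : ℕ) : CategoryTheory.Functor TopCat.{0} (ModuleCat.{0} ℤ) :=
  (AlgebraicTopology.singularHomologyFunctor (ModuleCat.{0} ℤ) i).obj (ModuleCat.of ℤ ℤ)

/-- The map from a space to the one-point space. -/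
def toPoint (X : TopCat.{0}) : X ⟶ TopCat.of PUnit.{1} :=
  TopCat.ofHom (ContinuousMap.const X PUnit.unit)

/-- Reduced singular homology `H̃_i(X; ℤ)` for `i ≥ 0`: the kernel of the map
`H_i(X; ℤ) → H_i(point; ℤ)`. For `i ≥ 1` this is all of `H_i(X; ℤ)`. -/
noncomputable def reducedHomology (i : ℕ) (X : TopCat.{0}) :
    Submodule ℤ ((integralHomology i).obj X) :=
  LinearMap.ker ((integralHomology i).map (toPoint X)).hom

/-- The Betti number `β_i(X)`: the rank of the `i`-th reduced homology group. -/
noncomputable def betti (i : ℕ) (X : TopCat.{0}) : ℕ :=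
  Module.finrank ℤ (reducedHomology i X)

/-- `T` is a `d`-dimensional spanning tree of the complex `Σ` (for `d ≥ 1`). -/
structure IsSpanningTree {n : ℕ} (d : ℕ) (Sig T : Set (Set (EuclideanSpace ℝ (Fin n)))) :
    Prop where
  subcomplex : IsSubcomplex T Sig
  spanning : skeleton T (d - 1) = skeleton Sig (d - 1)
  acyclic : Subsingleton (reducedHomology d (realization T))
  connected : Finite (reducedHomology (d - 1) (realization T))
  count : (faceCount T d : ℤ) = (faceCount Sig d : ℤ) - (betti d (realization Sig) : ℤ)

/-! Put j = k - 1 and let f be the number of k-cells of T. As T has the same j-skeleton as P, its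
space is that of P_j with f convex k-cells attached along their relative boundaries
(`exists_isCellAttachment`). Let U be the space of T with one relative interior point removed from
each k-cell, and V the union of small discs of the cells around these points. Radial projection
retracts U onto P_j (`IsCellAttachment.homotopyEquiv`), V consists of f contractible pieces, and U ∩
V of f punctured discs, each with reduced homology of rank one in degree j
(`reducedRank_compl_zero`).

Let p be the rank of H_j of a point. In the Mayer-Vietoris sequence of U and V the group H_{j+1}(T)
vanishes, and the image in H_j(T) has rank p, because it maps onto H_j of a point with finite
kernel. Counting ranks gives rank H_j(U) + f p = f (1 + p) + p, while rank H_j(U) = β_j(P_j) + p;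
hence β_j(P_j) = f (`reducedRank_eq_of_isOpen_cover`, `IsCellAttachment.reducedRank_eq_card`).
Carrying p along treats j = 0, where p = 1, together with j > 0, where p = 0.

The Mayer-Vietoris sequence comes from small chains. The chains of the union of two simplicial
subsets form a pushout, hence a short exact sequence; iterated barycentric subdivision shows that
chains lying in one of two open sets compute the homology of their union
(`exists_sub_boundary_mem_smallChains`, `bijective_intHomologyMap_range_sup_ι`).

The convex geometry rests on the gauge of a cell about an interior point. A point of gauge one lies
in an exposed face of smaller dimension, and an exposed face of P containing a point of gauge less
than one contains the whole cell. -/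

section

/-! ### Chains on tuples of points and barycentric subdivision -/

/-- Integral chains on `(n + 1)`-tuples of elements of `K`. -/
abbrev TupleChain (K : Type*) (n : ℕ) := (Fin (n + 1) → K) →₀ ℤ

namespace TupleChain

variable {K L : Type*}

/-- The alternating sum of the faces of a tuple. -/
noncomputable def boundary (n : ℕ) : TupleChain K (n + 1) →ₗ[ℤ] TupleChain K n :=
  Finsupp.linearCombination ℤ fun v ↦
    ∑ i : Fin (n + 2), (-1 : ℤ) ^ (i : ℕ) • Finsupp.single (v ∘ i.succAbove) 1

/-- The cone with apex `b`. -/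
noncomputable def cone (b : K) (n : ℕ) : TupleChain K n →ₗ[ℤ] TupleChain K (n + 1) :=
  Finsupp.lmapDomain ℤ ℤ fun v ↦ (Fin.cons b v : Fin (n + 2) → K)

/-- The map of chains induced by a map of points. -/
noncomputable def map (f : K → L) (n : ℕ) : TupleChain K n →ₗ[ℤ] TupleChain L n :=
  Finsupp.lmapDomain ℤ ℤ fun v ↦ f ∘ v

@[simp] lemma boundary_single (n : ℕ) (v : Fin (n + 2) → K) :
    boundary n (Finsupp.single v 1) =
      ∑ i : Fin (n + 2), (-1 : ℤ) ^ (i : ℕ) • Finsupp.single (v ∘ i.succAbove) 1 := by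
  simp [boundary]

@[simp] lemma cone_single (b : K) (n : ℕ) (v : Fin (n + 1) → K) :
    cone b n (Finsupp.single v 1) = Finsupp.single (Fin.cons b v : Fin (n + 2) → K) 1 := by
  simp [cone]

@[simp] lemma map_single (f : K → L) (n : ℕ) (v : Fin (n + 1) → K) :
    map f n (Finsupp.single v 1) = Finsupp.single (f ∘ v) 1 := by
  simp [map]

lemma hom_ext {n : ℕ} {M : Type*} [AddCommGroup M] {f g : TupleChain K n →ₗ[ℤ] M}
    (h : ∀ v, f (Finsupp.single v 1) = g (Finsupp.single v 1)) : f = g :=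
  Finsupp.lhom_ext' fun v ↦ LinearMap.ext_ring (h v)

lemma addHom_ext {n : ℕ} {M : Type*} [AddCommGroup M] {f g : TupleChain K n →+ M}
    (h : ∀ v, f (Finsupp.single v 1) = g (Finsupp.single v 1)) : f = g :=
  Finsupp.addHom_ext' fun v ↦ AddMonoidHom.ext_int (h v)

lemma cons_comp_succAbove_succ {n : ℕ} (b : K) (v : Fin (n + 1) → K) (j : Fin (n + 1)) :
    (Fin.cons b v : Fin (n + 2) → K) ∘ j.succ.succAbove =
      (Fin.cases b (fun i ↦ (v (j.succAbove i))) : Fin (n + 1) → K) := by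
  funext i
  refine Fin.cases ?_ (fun i ↦ ?_) i <;> simp

/-- Omitting the apex returns the base; omitting any other vertex gives a cone over a face of the
base, with its sign shifted by one. -/
lemma boundary_cone (n : ℕ) (b : K) (c : TupleChain K (n + 1)) :
    boundary (n + 1) (cone b (n + 1) c) = c - cone b n (boundary n c) := by
  suffices boundary (n + 1) ∘ₗ cone b (n + 1) = LinearMap.id - cone b n ∘ₗ boundary n from
    LinearMap.congr_fun this c
  refine hom_ext fun v ↦ ?_
  simp only [LinearMap.comp_apply, cone_single, boundary_single, LinearMap.sub_apply,
    LinearMap.id_apply, map_sum, map_zsmul]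
  rw [Fin.sum_univ_succ]
  simp only [cons_comp_succAbove_succ, Fin.val_succ, pow_succ, mul_neg, mul_one, neg_smul,
    Finset.sum_neg_distrib, ← sub_eq_add_neg]
  simp only [Fin.val_zero, pow_zero, one_smul]
  congr 1

/-- Over 0-chains the cone formula has an error term: the augmentation times the apex. It vanishes
here since boundaries have augmentation zero. -/
lemma boundary_cone_boundary (b : K) (c : TupleChain K 1) :
    boundary 0 (cone b 0 (boundary 0 c)) = boundary 0 c := by
  suffices boundary 0 ∘ₗ cone b 0 ∘ₗ boundary 0 = boundary 0 from LinearMap.congr_fun this c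
  refine hom_ext fun v ↦ ?_
  have h (w : Fin 1 → K) : (Fin.cons b w : Fin 2 → K) ∘ Fin.succAbove 0 = w := by
    funext i; simp
  have h' (w : Fin 1 → K) : (Fin.cons b w : Fin 2 → K) ∘ Fin.succAbove (Fin.succ 0) = fun _ ↦ b := by
    funext i; fin_cases i; simp
  simp only [LinearMap.comp_apply, boundary_single, Fin.sum_univ_succ, Finset.univ_eq_empty,
    Finset.sum_empty, map_add, map_neg, cone_single, h, h', Fin.val_zero, Fin.val_succ, zero_add,
    add_zero, pow_zero, pow_one, one_smul, neg_smul]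
  abel

/-- Every tuple is the cone from its first entry over its tail, so induction with the cone formula
replaces the usual cancellation in a double sum. -/
lemma boundary_boundary (n : ℕ) (c : TupleChain K (n + 2)) :
    boundary n (boundary (n + 1) c) = 0 := by
  suffices boundary n ∘ₗ boundary (n + 1) = (0 : TupleChain K (n + 2) →ₗ[ℤ] _) from
    LinearMap.congr_fun this c
  clear c
  induction n with
  | zero =>
    refine hom_ext fun v ↦ ?_
    rw [← Fin.cons_self_tail v, ← cone_single]
    simp only [LinearMap.comp_apply]
    rw [boundary_cone, map_sub, boundary_cone_boundary, sub_self, LinearMap.zero_apply]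
  | succ n ih =>
    refine hom_ext fun v ↦ ?_
    rw [← Fin.cons_self_tail v, ← cone_single]
    simp only [LinearMap.comp_apply]
    rw [boundary_cone, map_sub, boundary_cone, ← LinearMap.comp_apply (boundary n), ih]
    simp

lemma map_boundary (f : K → L) (n : ℕ) (c : TupleChain K (n + 1)) :
    map f n (boundary n c) = boundary n (map f (n + 1) c) := by
  suffices map f n ∘ₗ boundary n = boundary n ∘ₗ map f (n + 1) from LinearMap.congr_fun this c
  exact hom_ext fun v ↦ by
    simp only [LinearMap.comp_apply, boundary_single, map_sum, map_zsmul, map_single,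
      Function.comp_assoc]

lemma map_cone (f : K → L) (b : K) (n : ℕ) (c : TupleChain K n) :
    map f (n + 1) (cone b n c) = cone (f b) n (map f n c) := by
  suffices map f (n + 1) ∘ₗ cone b n = cone (f b) n ∘ₗ map f n from LinearMap.congr_fun this c
  refine hom_ext fun v ↦ ?_
  simp only [LinearMap.comp_apply, cone_single, map_single]
  congr 1
  funext i
  refine Fin.cases ?_ (fun i ↦ ?_) i <;> simp

section Subdivision

variable (β : ∀ n : ℕ, (Fin (n + 1) → K) → K) (γ : ∀ n : ℕ, (Fin (n + 1) → L) → L)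

/-- Subdivision of chains on tuples, where `β` is the choice of barycenters. -/
noncomputable def subdiv : ∀ n : ℕ, TupleChain K n →ₗ[ℤ] TupleChain K n
  | 0 => LinearMap.id
  | n + 1 => Finsupp.linearCombination ℤ fun v ↦
      cone (β (n + 1) v) n (subdiv n (boundary n (Finsupp.single v 1)))

/-- The chain homotopy between the identity and the subdivision. -/
noncomputable def subdivHomotopy : ∀ n : ℕ, TupleChain K n →ₗ[ℤ] TupleChain K (n + 1)
  | 0 => 0
  | n + 1 => Finsupp.linearCombination ℤ fun v ↦ cone (β (n + 1) v) (n + 1)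
      (Finsupp.single v 1 - subdivHomotopy n (boundary n (Finsupp.single v 1)))

lemma subdiv_single (n : ℕ) (v : Fin (n + 2) → K) :
    subdiv β (n + 1) (Finsupp.single v 1) =
      cone (β (n + 1) v) n (subdiv β n (boundary n (Finsupp.single v 1))) := by
  simp [subdiv]

lemma subdivHomotopy_single (n : ℕ) (v : Fin (n + 2) → K) :
    subdivHomotopy β (n + 1) (Finsupp.single v 1) = cone (β (n + 1) v) (n + 1)
      (Finsupp.single v 1 - subdivHomotopy β n (boundary n (Finsupp.single v 1))) := by
  simp [subdivHomotopy]

lemma boundary_subdiv (n : ℕ) (c : TupleChain K (n + 1)) :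
    boundary n (subdiv β (n + 1) c) = subdiv β n (boundary n c) := by
  suffices boundary n ∘ₗ subdiv β (n + 1) = subdiv β n ∘ₗ boundary n from
    LinearMap.congr_fun this c
  clear c
  induction n with
  | zero =>
    refine hom_ext fun v ↦ ?_
    simp only [LinearMap.comp_apply, subdiv_single]
    exact boundary_cone_boundary _ _
  | succ n ih =>
    refine hom_ext fun v ↦ ?_
    simp only [LinearMap.comp_apply, subdiv_single]
    rw [boundary_cone, ← LinearMap.comp_apply (boundary n), ih, LinearMap.comp_apply,
      boundary_boundary, map_zero, map_zero, sub_zero]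

lemma boundary_subdivHomotopy_zero (c : TupleChain K 0) :
    boundary 0 (subdivHomotopy β 0 c) = c - subdiv β 0 c := by
  simp [subdivHomotopy, subdiv]

/-- With D v = b(v - D∂v), the cone formula gives ∂D v = v - D∂v - b(∂v - ∂D∂v). By induction the
last bracket is the subdivision of ∂v, whose cone is the subdivision of v. -/
lemma boundary_subdivHomotopy (n : ℕ) (c : TupleChain K (n + 1)) :
    boundary (n + 1) (subdivHomotopy β (n + 1) c) + subdivHomotopy β n (boundary n c) =
      c - subdiv β (n + 1) c := by
  suffices boundary (n + 1) ∘ₗ subdivHomotopy β (n + 1) + subdivHomotopy β n ∘ₗ boundary n =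
    LinearMap.id - subdiv β (n + 1) from LinearMap.congr_fun this c
  clear c
  induction n with
  | zero =>
    refine hom_ext fun v ↦ ?_
    simp only [LinearMap.comp_apply, LinearMap.add_apply, LinearMap.sub_apply,
      subdivHomotopy_single, LinearMap.id_apply, subdiv_single]
    rw [boundary_cone, map_sub, boundary_subdivHomotopy_zero]
    simp only [map_sub]
    abel
  | succ n ih =>
    refine hom_ext fun v ↦ ?_
    have h := LinearMap.congr_fun ih (boundary (n + 1) (Finsupp.single v 1))
    simp only [LinearMap.comp_apply, LinearMap.add_apply, LinearMap.sub_apply,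
      subdivHomotopy_single, LinearMap.id_apply, subdiv_single, boundary_boundary, map_zero,
      add_zero] at h ⊢
    rw [boundary_cone, map_sub, h]
    simp only [map_sub]
    abel

variable {β γ}

/-- Compatibility with the chosen barycenters is all that naturality needs. Affine maps have it, so
subdivision passes from the model simplices to singular chains. -/
lemma map_subdiv {f : K → L} (hf : ∀ n v, f (β n v) = γ n (f ∘ v)) (n : ℕ) (c : TupleChain K n) :
    map f n (subdiv β n c) = subdiv γ n (map f n c) := by
  suffices map f n ∘ₗ subdiv β n = subdiv γ n ∘ₗ map f n from LinearMap.congr_fun this c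
  clear c
  induction n with
  | zero => rfl
  | succ n ih =>
    refine hom_ext fun v ↦ ?_
    simp only [LinearMap.comp_apply, subdiv_single, map_single]
    rw [map_cone, ← LinearMap.comp_apply (map f n), ih, LinearMap.comp_apply, map_boundary,
      map_single, hf]

lemma map_subdivHomotopy {f : K → L} (hf : ∀ n v, f (β n v) = γ n (f ∘ v)) (n : ℕ)
    (c : TupleChain K n) :
    map f (n + 1) (subdivHomotopy β n c) = subdivHomotopy γ n (map f n c) := by
  suffices map f (n + 1) ∘ₗ subdivHomotopy β n = subdivHomotopy γ n ∘ₗ map f n from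
    LinearMap.congr_fun this c
  clear c
  induction n with
  | zero => simp [subdivHomotopy]
  | succ n ih =>
    refine hom_ext fun v ↦ ?_
    simp only [LinearMap.comp_apply, subdivHomotopy_single, map_single]
    rw [map_cone, map_sub, ← LinearMap.comp_apply (map f (n + 1)), ih, LinearMap.comp_apply,
      map_boundary, map_single, hf]

end Subdivision

/-! ### Supports of chains and the mesh of a subdivision -/

/-- The chains supported on tuples with a given property. -/
abbrev supportedOn {n : ℕ} (p : (Fin (n + 1) → K) → Prop) : Submodule ℤ (TupleChain K n) :=
  Finsupp.supported ℤ ℤ {v | p v}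

lemma single_mem_supportedOn {n : ℕ} {p : (Fin (n + 1) → K) → Prop} {v : Fin (n + 1) → K}
    (h : p v) : Finsupp.single v 1 ∈ supportedOn p :=
  Finsupp.single_mem_supported ℤ 1 h

lemma map_mem_of_supportedOn {n : ℕ} {p : (Fin (n + 1) → K) → Prop} {M : Type*} [AddCommGroup M]
    (f : TupleChain K n →+ M) (N : AddSubgroup M)
    (h : ∀ v, p v → f (Finsupp.single v 1) ∈ N) {c : TupleChain K n} (hc : c ∈ supportedOn p) :
    f c ∈ N := by
  rw [← Finsupp.sum_single c, Finsupp.sum, map_sum]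
  refine N.sum_mem fun v hv ↦ ?_
  have : Finsupp.single v (c v) = c v • Finsupp.single v (1 : ℤ) := by simp
  rw [this, map_zsmul]
  exact N.zsmul_mem (h v (hc hv)) _

variable {β : ∀ n : ℕ, (Fin (n + 1) → K) → K}

/-- Every new vertex is an iterated barycenter of old ones. The mesh estimate applies this to a ball
around a barycenter. -/
lemma subdiv_mem_supportedOn_of_closed {C : Set K}
    (hC : ∀ n v, (∀ i, v i ∈ C) → β n v ∈ C) (n : ℕ) {v : Fin (n + 1) → K} (hv : ∀ i, v i ∈ C) :
    subdiv β n (Finsupp.single v 1) ∈ supportedOn fun w ↦ ∀ i, w i ∈ C := by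
  induction n with
  | zero => exact single_mem_supportedOn hv
  | succ n ih =>
    rw [subdiv_single, boundary_single, map_sum, map_sum]
    refine Submodule.sum_mem _ fun i _ ↦ ?_
    rw [map_zsmul, map_zsmul]
    refine Submodule.smul_mem _ _ ?_
    refine map_mem_of_supportedOn (cone _ n).toAddMonoidHom (supportedOn _).toAddSubgroup
      (fun w hw ↦ ?_) (ih (v := v ∘ i.succAbove) fun j ↦ hv _)
    rw [LinearMap.toAddMonoidHom_coe, cone_single]
    refine single_mem_supportedOn fun j ↦ ?_
    refine Fin.cases ?_ (fun j ↦ ?_) j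
    · exact hC _ _ hv
    · exact hw j

/-- Subdivision shrinks the mutual distances of the vertices by the factor `n / (n + 1)`. -/
lemma subdiv_mem_supportedOn_dist_le [PseudoMetricSpace K]
    (hball : ∀ (x : K) (r : ℝ) n v, (∀ i, dist x (v i) ≤ r) → dist x (β n v) ≤ r)
    (hdist : ∀ (d : ℝ) n v, (∀ i j, dist (v i) (v j) ≤ d) →
      ∀ i, dist (β n v) (v i) ≤ n / (n + 1) * d)
    (n : ℕ) {d : ℝ} {v : Fin (n + 1) → K} (hv : ∀ i j, dist (v i) (v j) ≤ d) :
    subdiv β n (Finsupp.single v 1) ∈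
      supportedOn fun w ↦ ∀ i j, dist (w i) (w j) ≤ n / (n + 1) * d := by
  have hd : 0 ≤ d := dist_nonneg.trans (hv 0 0)
  induction n with
  | zero =>
    refine single_mem_supportedOn fun i j ↦ ?_
    rw [Fin.fin_one_eq_zero i, Fin.fin_one_eq_zero j]
    simp
  | succ n ih =>
    rw [subdiv_single, boundary_single, map_sum, map_sum]
    refine Submodule.sum_mem _ fun i _ ↦ ?_
    rw [map_zsmul, map_zsmul]
    refine Submodule.smul_mem _ _ ?_
    have h₁ := ih (v := v ∘ i.succAbove) fun j k ↦ hv _ _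
    -- The ball about the new apex contains all the original vertices by `hdist` and is closed under
    -- barycenters by `hball`, so it bounds the edges from the apex; `h₁` bounds the others.
    have h₂ := subdiv_mem_supportedOn_of_closed (β := β)
      (C := {x | dist (β (n + 1) v) x ≤ (n + 1 : ℕ) / ((n + 1 : ℕ) + 1) * d})
      (fun m w hw ↦ hball _ _ m w hw) n (v := v ∘ i.succAbove)
      fun j ↦ hdist d (n + 1) v hv _
    have h₃ : subdiv β n (Finsupp.single (v ∘ i.succAbove) 1) ∈ supportedOn fun w ↦
        (∀ i j, dist (w i) (w j) ≤ n / (n + 1) * d) ∧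
        ∀ i, dist (β (n + 1) v) (w i) ≤ (n + 1 : ℕ) / ((n + 1 : ℕ) + 1) * d :=
      fun w hw ↦ ⟨h₁ hw, h₂ hw⟩
    refine map_mem_of_supportedOn (cone _ n).toAddMonoidHom (supportedOn _).toAddSubgroup
      (fun w hw ↦ ?_) h₃
    rw [LinearMap.toAddMonoidHom_coe, cone_single]
    have hmono : (n : ℝ) / (n + 1) * d ≤ (n + 1 : ℕ) / ((n + 1 : ℕ) + 1) * d := by
      refine mul_le_mul_of_nonneg_right ?_ hd
      rw [div_le_div_iff₀ (by positivity) (by positivity)]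
      push_cast
      nlinarith
    refine single_mem_supportedOn fun j k ↦ ?_
    refine Fin.cases ?_ (fun j ↦ ?_) j <;> refine Fin.cases ?_ (fun k ↦ ?_) k
    · simp only [Fin.cons_zero, dist_self]
      positivity
    · exact hw.2 k
    · rw [dist_comm]
      exact hw.2 j
    · exact (hw.1 j k).trans hmono

end TupleChain

end

section

/-! ### Affine maps between standard simplices -/

namespace stdSimplex

variable {l m n : ℕ}

/-- The affine map of standard simplices with prescribed vertices. -/
noncomputable def affineMap (v : Fin (m + 1) → stdSimplex ℝ (Fin (n + 1))) :
    C(stdSimplex ℝ (Fin (m + 1)), stdSimplex ℝ (Fin (n + 1))) where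
  toFun t := ⟨∑ i, t i • (v i).val, (convex_stdSimplex ℝ (Fin (n + 1))).sum_mem
    (fun i _ ↦ t.2.1 i) t.2.2 fun i _ ↦ (v i).2⟩
  continuous_toFun := by
    refine Continuous.subtype_mk (continuous_finsetSum _ fun i _ ↦ ?_) _
    exact ((continuous_apply i).comp continuous_subtype_val).smul continuous_const

lemma affineMap_val (v : Fin (m + 1) → stdSimplex ℝ (Fin (n + 1)))
    (t : stdSimplex ℝ (Fin (m + 1))) : (affineMap v t).val = ∑ i, t i • (v i).val := rfl

lemma affineMap_comp (w : Fin (m + 1) → stdSimplex ℝ (Fin (n + 1)))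
    (v : Fin (l + 1) → stdSimplex ℝ (Fin (m + 1))) :
    (affineMap w).comp (affineMap v) = affineMap (affineMap w ∘ v) := by
  refine ContinuousMap.ext fun t ↦ Subtype.ext ?_
  change ∑ i, (∑ j, t j • (v j).val) i • (w i).val = ∑ j, t j • ∑ i, (v j).val i • (w i).val
  simp only [Finset.sum_apply, Pi.smul_apply, smul_eq_mul, Finset.sum_smul, Finset.smul_sum,
    smul_smul]
  exact Finset.sum_comm

lemma affineMap_comp_apply (w : Fin (m + 1) → stdSimplex ℝ (Fin (n + 1)))
    (v : Fin (l + 1) → stdSimplex ℝ (Fin (m + 1))) (t : stdSimplex ℝ (Fin (l + 1))) :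
    affineMap w (affineMap v t) = affineMap (affineMap w ∘ v) t :=
  DFunLike.congr_fun (affineMap_comp w v) t

lemma affineMap_vertex (v : Fin (m + 1) → stdSimplex ℝ (Fin (n + 1))) (i : Fin (m + 1)) :
    affineMap v (vertex i) = v i := by
  refine Subtype.ext ?_
  rw [affineMap_val, Finset.sum_eq_single i]
  · simp
  · intro j _ hj
    simp [hj]
  · simp

lemma affineMap_vertex_comp (f : Fin (m + 1) → Fin (n + 1)) (t : stdSimplex ℝ (Fin (m + 1))) :
    affineMap (fun i ↦ vertex (f i)) t = map f t := by
  refine Subtype.ext (funext fun j ↦ ?_)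
  change (∑ i, t i • (Pi.single (f i) 1 : Fin (n + 1) → ℝ)) j = FunOnFinite.linearMap ℝ ℝ f t j
  rw [FunOnFinite.linearMap_apply_apply, Finset.sum_apply, Finset.sum_filter]
  refine Finset.sum_congr rfl fun i _ ↦ ?_
  simp [Pi.single_apply, eq_comm]

lemma affineMap_id : affineMap (vertex : Fin (n + 1) → stdSimplex ℝ (Fin (n + 1))) =
    ContinuousMap.id _ := by
  refine ContinuousMap.ext fun t ↦ ?_
  exact (affineMap_vertex_comp id t).trans (map_id_apply t)

/-- The barycenter of a tuple of points of the standard simplex. -/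
noncomputable def tupleBarycenter (n m : ℕ) (v : Fin (m + 1) → stdSimplex ℝ (Fin (n + 1))) :
    stdSimplex ℝ (Fin (n + 1)) := affineMap v barycenter

lemma affineMap_tupleBarycenter (w : Fin (m + 1) → stdSimplex ℝ (Fin (n + 1))) (l : ℕ)
    (v : Fin (l + 1) → stdSimplex ℝ (Fin (m + 1))) :
    affineMap w (tupleBarycenter m l v) = tupleBarycenter n l (affineMap w ∘ v) :=
  affineMap_comp_apply _ _ _

lemma dist_affineMap_le (x : stdSimplex ℝ (Fin (n + 1))) (r : ℝ)
    (v : Fin (m + 1) → stdSimplex ℝ (Fin (n + 1))) (h : ∀ i, dist x (v i) ≤ r)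
    (t : stdSimplex ℝ (Fin (m + 1))) : dist x (affineMap v t) ≤ r := by
  have : (affineMap v t).val ∈ Metric.closedBall x.val r := by
    rw [affineMap_val]
    refine (convex_closedBall x.val r).sum_mem (fun i _ ↦ t.2.1 i) t.2.2 fun i _ ↦ ?_
    rw [Metric.mem_closedBall, dist_comm]
    exact h i
  rw [Metric.mem_closedBall, dist_comm] at this
  exact this

/-- The difference is the mean of the m + 1 vectors from `v i` to the vertices. One of them is zero,
hence the factor m / (m + 1). -/
lemma dist_tupleBarycenter_le (n : ℕ) (d : ℝ) (m : ℕ)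
    (v : Fin (m + 1) → stdSimplex ℝ (Fin (n + 1))) (h : ∀ i j, dist (v i) (v j) ≤ d)
    (i : Fin (m + 1)) : dist (tupleBarycenter n m v) (v i) ≤ m / (m + 1) * d := by
  have hm : (m + 1 : ℝ) ≠ 0 := by positivity
  have h₁ : (tupleBarycenter n m v).val - (v i).val =
      ∑ j, (m + 1 : ℝ)⁻¹ • ((v j).val - (v i).val) := by
    rw [tupleBarycenter, affineMap_val, ← Finset.smul_sum, Finset.sum_sub_distrib, smul_sub,
      Finset.sum_const, Finset.card_univ, Fintype.card_fin, ← Nat.cast_smul_eq_nsmul ℝ, smul_smul,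
      Finset.smul_sum]
    push_cast
    rw [inv_mul_cancel₀ hm, one_smul]
    congr 1
    refine Finset.sum_congr rfl fun j _ ↦ ?_
    congr 1
    change ((Fintype.card (Fin (m + 1)) : ℝ))⁻¹ = _
    simp
  rw [Subtype.dist_eq, dist_eq_norm, h₁, ← Finset.add_sum_erase _ _ (Finset.mem_univ i), sub_self,
    smul_zero, zero_add]
  refine (norm_sum_le _ _).trans ?_
  have h₂ : ∀ j ∈ Finset.univ.erase i, ‖(m + 1 : ℝ)⁻¹ • ((v j).val - (v i).val)‖ ≤
      (m + 1 : ℝ)⁻¹ * d := fun j _ ↦ by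
    rw [norm_smul, Real.norm_of_nonneg (by positivity)]
    refine mul_le_mul_of_nonneg_left ?_ (by positivity)
    rw [← dist_eq_norm]
    exact h j i
  refine (Finset.sum_le_card_nsmul _ _ _ h₂).trans (le_of_eq ?_)
  rw [Finset.card_erase_of_mem (Finset.mem_univ i), Finset.card_univ, Fintype.card_fin,
    nsmul_eq_mul]
  simp only [add_tsub_cancel_right]
  field_simp

end stdSimplex

/-! ### Generators of the chain complex of a simplicial set -/

open CategoryTheory Simplicial Opposite

namespace SSet

/-- The complex of integral chains of a simplicial set. -/
noncomputable abbrev intChains (X : SSet.{0}) : ChainComplex (ModuleCat.{0} ℤ) ℕ :=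
  X.chainComplex (ModuleCat.of ℤ ℤ)

variable {X Y : SSet.{0}}

/-- The chain given by a simplex. -/
noncomputable def chainOf {n : ℕ} (x : X _⦋n⦌) : X.intChains.X n :=
  (X.ιChainComplex (R := ModuleCat.of ℤ ℤ) x).hom (1 : ℤ)

lemma d_chainOf {n : ℕ} (x : X _⦋n + 1⦌) :
    (X.intChains.d (n + 1) n).hom.toAddMonoidHom (chainOf x) =
      ∑ i : Fin (n + 2), ((-1 : ℤ) ^ (i : ℕ) • chainOf (X.δ i x) : X.intChains.X n) := by
  have := congr(($(X.ιChainComplex_d (ModuleCat.of ℤ ℤ) x)).hom (1 : ℤ))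
  simp only [ModuleCat.hom_comp, LinearMap.comp_apply] at this
  refine this.trans ?_
  simp [ModuleCat.hom_sum, chainOf]

lemma chainMap_chainOf (f : X ⟶ Y) {n : ℕ} (x : X _⦋n⦌) :
    ((SSet.chainComplexMap f (ModuleCat.of ℤ ℤ)).f n).hom (chainOf x) = chainOf (f.app _ x) :=
  congr(($(ι_chainComplexMap_f X Y f (ModuleCat.of ℤ ℤ) x)).hom (1 : ℤ))

lemma intChains_hom_ext {n : ℕ} {M : Type} [AddCommGroup M] {f g : X.intChains.X n →+ M}
    (h : ∀ x : X _⦋n⦌, f (chainOf x) = g (chainOf x)) : f = g := by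
  let F (f : X.intChains.X n →+ M) : X.intChains.X n ⟶ ModuleCat.of ℤ M :=
    ModuleCat.ofHom { f with
      map_smul' := fun a x ↦ (congrArg f (int_smul_eq_zsmul _ a x)).trans (map_zsmul f a x) }
  have : F f = F g := by
    refine chainComplex_hom_ext fun x ↦ ?_
    refine ModuleCat.hom_ext (LinearMap.ext_ring ?_)
    exact h x
  exact AddMonoidHom.ext fun c ↦ congr(($this).hom c)

/-- The homomorphism on chains with prescribed values on simplices. -/
noncomputable def chainsLift {n : ℕ} {M : Type} [AddCommGroup M] (f : X _⦋n⦌ → M) :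
    X.intChains.X n →+ M :=
  ((X.isColimitChainComplexXCofan (ModuleCat.of ℤ ℤ) n).desc (Limits.Cofan.mk (ModuleCat.of ℤ M)
    fun x ↦ ModuleCat.ofHom (LinearMap.toSpanSingleton ℤ M (f x)))).hom.toAddMonoidHom

lemma chainsLift_chainOf {n : ℕ} {M : Type} [AddCommGroup M] (f : X _⦋n⦌ → M) (x : X _⦋n⦌) :
    chainsLift f (chainOf x) = f x := by
  have := congr(($((X.isColimitChainComplexXCofan (ModuleCat.of ℤ ℤ) n).fac
    (Limits.Cofan.mk (ModuleCat.of ℤ M)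
    fun x ↦ ModuleCat.ofHom (LinearMap.toSpanSingleton ℤ M (f x))) ⟨x⟩)).hom (1 : ℤ))
  refine this.trans ?_
  simp only [Limits.Cofan.mk_ι_app, ModuleCat.hom_ofHom]
  change (LinearMap.toSpanSingleton ℤ M (f x)) (1 : ℤ) = f x
  rw [LinearMap.toSpanSingleton_apply, one_zsmul]

/-- The projection to the quotient by the span of the simplices kills every simplex, so it is zero.
-/
lemma closure_chainOf (n : ℕ) :
    AddSubgroup.closure (Set.range (chainOf : X _⦋n⦌ → X.intChains.X n)) = ⊤ := by
  set S := AddSubgroup.closure (Set.range (chainOf : X _⦋n⦌ → X.intChains.X n))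
  have h : QuotientAddGroup.mk' S = 0 := intChains_hom_ext fun x ↦
    (QuotientAddGroup.eq_zero_iff _).2 (AddSubgroup.subset_closure ⟨x, rfl⟩)
  exact eq_top_iff.2 fun c _ ↦ (QuotientAddGroup.eq_zero_iff c).1 congr($h c)

end SSet

end

section

open CategoryTheory Simplicial Opposite

/-! ### Subdivision of singular chains -/

namespace TopCat

open SSet stdSimplex TupleChain

variable {X Y : TopCat.{0}}

/-- The complex of integral singular chains of a space. -/
noncomputable abbrev singularChains (X : TopCat.{0}) : ChainComplex (ModuleCat.{0} ℤ) ℕ :=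
  (toSSet.obj X).intChains

/-- The simplex of the singular simplicial set given by a continuous map. -/
noncomputable def singularSimplex {n : ℕ} (σ : C(_root_.stdSimplex ℝ (Fin (n + 1)), X)) :
    (toSSet.obj X) _⦋n⦌ :=
  (toSSetObjEquiv X (op ⦋n⦌)).symm σ

lemma singularSimplex_surjective {n : ℕ} (x : (toSSet.obj X) _⦋n⦌) :
    ∃ σ, singularSimplex σ = x :=
  (toSSetObjEquiv X (op ⦋n⦌)).symm.surjective x

lemma singularSimplex_injective {n : ℕ} :
    Function.Injective (singularSimplex (X := X) (n := n)) :=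
  (toSSetObjEquiv X (op ⦋n⦌)).symm.injective

lemma δ_singularSimplex {n : ℕ} (σ : C(_root_.stdSimplex ℝ (Fin (n + 2)), X)) (i : Fin (n + 2)) :
    (toSSet.obj X).δ i (singularSimplex σ) =
      singularSimplex (σ.comp (affineMap (vertex ∘ i.succAbove))) := by
  have h : affineMap (vertex ∘ i.succAbove) = ⟨_, stdSimplex.continuous_map i.succAbove⟩ :=
    ContinuousMap.ext fun t ↦ affineMap_vertex_comp i.succAbove t
  rw [h]
  rfl

lemma map_singularSimplex (f : X ⟶ Y) {n : ℕ} (σ : C(_root_.stdSimplex ℝ (Fin (n + 1)), X)) :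
    (toSSet.map f).app (op ⦋n⦌) (singularSimplex σ) = singularSimplex (f.hom.comp σ) := rfl

/-- The singular chain given by a singular simplex. -/
noncomputable def singularChain {n : ℕ} (σ : C(_root_.stdSimplex ℝ (Fin (n + 1)), X)) :
    X.singularChains.X n :=
  chainOf (singularSimplex σ)

/-- The differential of the singular chain complex. -/
noncomputable def singularD (X : TopCat.{0}) (n : ℕ) :
    X.singularChains.X (n + 1) →+ X.singularChains.X n :=
  (X.singularChains.d (n + 1) n).hom.toAddMonoidHom

lemma d_singularChain {n : ℕ} (σ : C(_root_.stdSimplex ℝ (Fin (n + 2)), X)) :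
    singularD X n (singularChain σ) =
      ∑ i : Fin (n + 2), (-1 : ℤ) ^ (i : ℕ) •
        singularChain (σ.comp (affineMap (vertex ∘ i.succAbove))) := by
  rw [singularChain, singularD, d_chainOf]
  simp only [δ_singularSimplex, singularChain]

lemma singularChains_hom_ext {n : ℕ} {M : Type} [AddCommGroup M]
    {f g : X.singularChains.X n →+ M}
    (h : ∀ σ : C(_root_.stdSimplex ℝ (Fin (n + 1)), X),
      f (singularChain σ) = g (singularChain σ)) : f = g :=
  intChains_hom_ext fun x ↦ by
    obtain ⟨σ, rfl⟩ := singularSimplex_surjective x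
    exact h σ

/-- The singular chains obtained from tuple chains in the source of a singular simplex. -/
noncomputable def affineChain {n : ℕ} (σ : C(_root_.stdSimplex ℝ (Fin (n + 1)), X)) (m : ℕ) :
    TupleChain (_root_.stdSimplex ℝ (Fin (n + 1))) m →+ X.singularChains.X m :=
  Finsupp.liftAddHom fun v ↦ zmultiplesHom _ (singularChain (σ.comp (affineMap v)))

lemma affineChain_single {n : ℕ} (σ : C(_root_.stdSimplex ℝ (Fin (n + 1)), X)) (m : ℕ)
    (v : Fin (m + 1) → _root_.stdSimplex ℝ (Fin (n + 1))) :
    affineChain σ m (Finsupp.single v 1) = singularChain (σ.comp (affineMap v)) := by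
  simp [affineChain]

lemma affineChain_vertex {n : ℕ} (σ : C(_root_.stdSimplex ℝ (Fin (n + 1)), X)) :
    affineChain σ n (Finsupp.single vertex 1) = singularChain σ := by
  rw [affineChain_single, affineMap_id, ContinuousMap.comp_id]

lemma affineChain_comp {n m l : ℕ} (σ : C(_root_.stdSimplex ℝ (Fin (n + 1)), X))
    (v : Fin (m + 1) → _root_.stdSimplex ℝ (Fin (n + 1)))
    (c : TupleChain (_root_.stdSimplex ℝ (Fin (m + 1))) l) :
    affineChain (σ.comp (affineMap v)) l c = affineChain σ l (map (affineMap v) l c) := by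
  suffices affineChain (σ.comp (affineMap v)) l =
      (affineChain σ l).comp (map (affineMap v) l).toAddMonoidHom from
    DFunLike.congr_fun this c
  refine TupleChain.addHom_ext fun w ↦ ?_
  rw [AddMonoidHom.comp_apply, LinearMap.toAddMonoidHom_coe, map_single, affineChain_single, affineChain_single,
    ContinuousMap.comp_assoc, affineMap_comp]

lemma d_affineChain {n : ℕ} (σ : C(_root_.stdSimplex ℝ (Fin (n + 1)), X)) (m : ℕ)
    (c : TupleChain (_root_.stdSimplex ℝ (Fin (n + 1))) (m + 1)) :
    singularD X m (affineChain σ (m + 1) c) =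
      affineChain σ m (TupleChain.boundary m c) := by
  suffices (singularD X m).comp (affineChain σ (m + 1)) =
    (affineChain σ m).comp (TupleChain.boundary m).toAddMonoidHom from DFunLike.congr_fun this c
  refine TupleChain.addHom_ext fun v ↦ ?_
  rw [AddMonoidHom.comp_apply, AddMonoidHom.comp_apply, affineChain_single, d_singularChain,
    LinearMap.toAddMonoidHom_coe, boundary_single, map_sum]
  refine Finset.sum_congr rfl fun i _ ↦ ?_
  rw [map_zsmul, affineChain_single, ContinuousMap.comp_assoc, affineMap_comp,
    show affineMap v ∘ (vertex ∘ i.succAbove) = v ∘ i.succAbove from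
      funext fun j ↦ affineMap_vertex v _]

/-- Barycentric subdivision of singular chains. -/
noncomputable def singularSubdiv (X : TopCat.{0}) (n : ℕ) :
    X.singularChains.X n →+ X.singularChains.X n :=
  chainsLift fun x ↦ affineChain (toSSetObjEquiv X (op ⦋n⦌) x) n
    (subdiv (tupleBarycenter n) n (Finsupp.single vertex 1))

/-- The natural chain homotopy between the identity and barycentric subdivision. -/
noncomputable def singularSubdivHomotopy (X : TopCat.{0}) (n : ℕ) :
    X.singularChains.X n →+ X.singularChains.X (n + 1) :=
  chainsLift fun x ↦ affineChain (toSSetObjEquiv X (op ⦋n⦌) x) (n + 1)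
    (subdivHomotopy (tupleBarycenter n) n (Finsupp.single vertex 1))

lemma singularSubdiv_singularChain {n : ℕ} (σ : C(_root_.stdSimplex ℝ (Fin (n + 1)), X)) :
    singularSubdiv X n (singularChain σ) =
      affineChain σ n (subdiv (tupleBarycenter n) n (Finsupp.single vertex 1)) := by
  rw [singularSubdiv, singularChain, chainsLift_chainOf, singularSimplex, Equiv.apply_symm_apply]

lemma singularSubdivHomotopy_singularChain {n : ℕ}
    (σ : C(_root_.stdSimplex ℝ (Fin (n + 1)), X)) :
    singularSubdivHomotopy X n (singularChain σ) =
      affineChain σ (n + 1) (subdivHomotopy (tupleBarycenter n) n (Finsupp.single vertex 1)) := by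
  rw [singularSubdivHomotopy, singularChain, chainsLift_chainOf, singularSimplex,
    Equiv.apply_symm_apply]

lemma affineMap_comp_vertex {n m : ℕ} (v : Fin (m + 1) → _root_.stdSimplex ℝ (Fin (n + 1))) :
    affineMap v ∘ vertex = v :=
  funext fun i ↦ affineMap_vertex v i

/-- Affine maps preserve barycenters, so subdividing on the model of each singular simplex agrees
with subdividing inside the source of σ. Since σ itself is `affineChain σ` of the vertex tuple,
identities for tuple chains carry over to singular chains. -/
lemma singularSubdiv_affineChain {n : ℕ} (σ : C(_root_.stdSimplex ℝ (Fin (n + 1)), X)) (m : ℕ)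
    (c : TupleChain (_root_.stdSimplex ℝ (Fin (n + 1))) m) :
    singularSubdiv X m (affineChain σ m c) =
      affineChain σ m (subdiv (tupleBarycenter n) m c) := by
  suffices (singularSubdiv X m).comp (affineChain σ m) =
    (affineChain σ m).comp (subdiv (tupleBarycenter n) m).toAddMonoidHom from DFunLike.congr_fun this c
  refine TupleChain.addHom_ext fun v ↦ ?_
  rw [AddMonoidHom.comp_apply, AddMonoidHom.comp_apply, affineChain_single,
    singularSubdiv_singularChain, affineChain_comp,
    map_subdiv (γ := tupleBarycenter n) (affineMap_tupleBarycenter v), map_single,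
    affineMap_comp_vertex]
  rfl

lemma singularSubdivHomotopy_affineChain {n : ℕ} (σ : C(_root_.stdSimplex ℝ (Fin (n + 1)), X))
    (m : ℕ) (c : TupleChain (_root_.stdSimplex ℝ (Fin (n + 1))) m) :
    singularSubdivHomotopy X m (affineChain σ m c) =
      affineChain σ (m + 1) (subdivHomotopy (tupleBarycenter n) m c) := by
  suffices (singularSubdivHomotopy X m).comp (affineChain σ m) =
    (affineChain σ (m + 1)).comp (subdivHomotopy (tupleBarycenter n) m).toAddMonoidHom from
    DFunLike.congr_fun this c
  refine TupleChain.addHom_ext fun v ↦ ?_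
  rw [AddMonoidHom.comp_apply, AddMonoidHom.comp_apply, affineChain_single,
    singularSubdivHomotopy_singularChain, affineChain_comp,
    map_subdivHomotopy (γ := tupleBarycenter n) (affineMap_tupleBarycenter v), map_single,
    affineMap_comp_vertex]
  rfl

lemma d_singularSubdiv (n : ℕ) (c : X.singularChains.X (n + 1)) :
    singularD X n (singularSubdiv X (n + 1) c) =
      singularSubdiv X n (singularD X n c) := by
  suffices (singularD X n).comp (singularSubdiv X (n + 1)) =
    (singularSubdiv X n).comp (singularD X n) from DFunLike.congr_fun this c
  refine singularChains_hom_ext fun σ ↦ ?_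
  rw [AddMonoidHom.comp_apply, AddMonoidHom.comp_apply, ← affineChain_vertex, singularSubdiv_affineChain,
    d_affineChain, boundary_subdiv, d_affineChain, singularSubdiv_affineChain]

lemma d_singularSubdivHomotopy (n : ℕ) (c : X.singularChains.X (n + 1)) :
    singularD X (n + 1) (singularSubdivHomotopy X (n + 1) c) +
      singularSubdivHomotopy X n (singularD X n c) =
        c - singularSubdiv X (n + 1) c := by
  suffices (singularD X (n + 1)).comp (singularSubdivHomotopy X (n + 1)) +
      (singularSubdivHomotopy X n).comp (singularD X n) =
    AddMonoidHom.id _ - singularSubdiv X (n + 1) from DFunLike.congr_fun this c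
  refine singularChains_hom_ext fun σ ↦ ?_
  rw [AddMonoidHom.add_apply, AddMonoidHom.comp_apply, AddMonoidHom.comp_apply, AddMonoidHom.sub_apply,
    AddMonoidHom.id_apply, ← affineChain_vertex,
    singularSubdiv_affineChain, singularSubdivHomotopy_affineChain, d_affineChain,
    d_affineChain, singularSubdivHomotopy_affineChain, ← map_add, boundary_subdivHomotopy, map_sub]

end TopCat

end

section

open CategoryTheory Simplicial Opposite

/-! ### Small simplices -/

namespace TopCat

open SSet stdSimplex TupleChain

variable {X : TopCat.{0}} {ι : Type*} (c : ι → Set X)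

/-- The singular chains which are combinations of simplices contained in one of the sets `c i`. -/
noncomputable def smallChains (n : ℕ) : AddSubgroup (X.singularChains.X n) :=
  AddSubgroup.closure {s | ∃ σ : C(_root_.stdSimplex ℝ (Fin (n + 1)), X),
    (∃ i, ∀ t, σ t ∈ c i) ∧ singularChain σ = s}

variable {c}

lemma singularChain_mem_smallChains {n : ℕ} {σ : C(_root_.stdSimplex ℝ (Fin (n + 1)), X)}
    (h : ∃ i, ∀ t, σ t ∈ c i) : singularChain σ ∈ smallChains c n :=
  AddSubgroup.subset_closure ⟨σ, h, rfl⟩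

lemma affineChain_mem_smallChains {n : ℕ} {σ : C(_root_.stdSimplex ℝ (Fin (n + 1)), X)}
    (h : ∃ i, ∀ t, σ t ∈ c i) (m : ℕ) (s : TupleChain (_root_.stdSimplex ℝ (Fin (n + 1))) m) :
    affineChain σ m s ∈ smallChains c m := by
  refine map_mem_of_supportedOn (p := fun _ ↦ True) _ _ (fun v _ ↦ ?_) fun _ _ ↦ True.intro
  rw [affineChain_single]
  obtain ⟨i, hi⟩ := h
  exact singularChain_mem_smallChains ⟨i, fun t ↦ hi _⟩

lemma singularSubdiv_mem_smallChains {n : ℕ} {s : X.singularChains.X n}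
    (hs : s ∈ smallChains c n) : singularSubdiv X n s ∈ smallChains c n := by
  refine (AddSubgroup.closure_le ((smallChains c n).comap (singularSubdiv X n))).2 ?_ hs
  rintro _ ⟨σ, hσ, rfl⟩
  rw [SetLike.mem_coe, AddSubgroup.mem_comap, singularSubdiv_singularChain]
  exact affineChain_mem_smallChains hσ _ _

lemma singularSubdivHomotopy_mem_smallChains {n : ℕ} {s : X.singularChains.X n}
    (hs : s ∈ smallChains c n) : singularSubdivHomotopy X n s ∈ smallChains c (n + 1) := by
  refine (AddSubgroup.closure_le ((smallChains c (n + 1)).comap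
    (singularSubdivHomotopy X n))).2 ?_ hs
  rintro _ ⟨σ, hσ, rfl⟩
  rw [SetLike.mem_coe, AddSubgroup.mem_comap, singularSubdivHomotopy_singularChain]
  exact affineChain_mem_smallChains hσ _ _

lemma iterate_singularSubdiv_affineChain {n : ℕ} (σ : C(_root_.stdSimplex ℝ (Fin (n + 1)), X))
    (m k : ℕ) (s : TupleChain (_root_.stdSimplex ℝ (Fin (n + 1))) m) :
    (singularSubdiv X m)^[k] (affineChain σ m s) =
      affineChain σ m ((subdiv (tupleBarycenter n) m)^[k] s) := by
  induction k with
  | zero => rfl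
  | succ k ih =>
    rw [Function.iterate_succ_apply', ih, singularSubdiv_affineChain, Function.iterate_succ_apply']

lemma iterate_subdiv_mem_supportedOn_dist_le (n k : ℕ) :
    (subdiv (tupleBarycenter n) n)^[k] (Finsupp.single vertex 1) ∈
      supportedOn fun w ↦ ∀ i j, dist (w i) (w j) ≤
        ((n : ℝ) / (n + 1)) ^ k * Metric.diam (_root_.stdSimplex ℝ (Fin (n + 1))) := by
  induction k with
  | zero =>
    refine single_mem_supportedOn fun i j ↦ ?_
    rw [pow_zero, one_mul]
    exact Metric.dist_le_diam_of_mem (bounded_stdSimplex _) (vertex i).2 (vertex j).2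
  | succ k ih =>
    rw [Function.iterate_succ_apply']
    refine map_mem_of_supportedOn (subdiv (tupleBarycenter n) n).toAddMonoidHom
      (supportedOn _).toAddSubgroup (fun w hw ↦ ?_) ih
    have := subdiv_mem_supportedOn_dist_le (β := tupleBarycenter n)
      (fun x r m v h ↦ dist_affineMap_le x r v h barycenter) (dist_tupleBarycenter_le n) n hw
    rw [pow_succ', mul_assoc]
    exact this

/-- Every singular simplex becomes small after sufficiently many subdivisions. -/
lemma exists_iterate_singularSubdiv_singularChain (hc : ∀ i, IsOpen (c i)) (hcov : ⋃ i, c i = Set.univ)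
    {n : ℕ} (σ : C(_root_.stdSimplex ℝ (Fin (n + 1)), X)) :
    ∃ k₀, ∀ k ≥ k₀, (singularSubdiv X n)^[k] (singularChain σ) ∈ smallChains c n := by
  obtain ⟨δ, hδ, hball⟩ := lebesgue_number_lemma_of_metric (s := Set.univ) (c := fun i ↦ σ ⁻¹' c i)
    isCompact_univ (fun i ↦ (hc i).preimage σ.continuous) (by
      rw [← Set.preimage_iUnion, hcov, Set.preimage_univ])
  set d := Metric.diam (_root_.stdSimplex ℝ (Fin (n + 1)))
  have hd : 0 ≤ d := Metric.diam_nonneg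
  have hr : (n : ℝ) / (n + 1) < 1 := by
    rw [div_lt_one (by positivity)]
    exact lt_add_one _
  -- Here δ is a Lebesgue number of the pulled-back cover. Dividing by d + 1 rather than d allows
  -- for a simplex of diameter zero.
  obtain ⟨k₀, hk₀⟩ := exists_pow_lt_of_lt_one (show 0 < δ / (d + 1) by positivity) hr
  refine ⟨k₀, fun k hk ↦ ?_⟩
  have hlt : ((n : ℝ) / (n + 1)) ^ k * d < δ := by
    have h₁ : ((n : ℝ) / (n + 1)) ^ k ≤ ((n : ℝ) / (n + 1)) ^ k₀ :=
      pow_le_pow_of_le_one (by positivity) hr.le hk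
    calc ((n : ℝ) / (n + 1)) ^ k * d ≤ δ / (d + 1) * d :=
          mul_le_mul_of_nonneg_right (h₁.trans hk₀.le) hd
      _ < δ := by
          rw [div_mul_eq_mul_div, div_lt_iff₀ (by positivity)]
          nlinarith
  rw [← affineChain_vertex, iterate_singularSubdiv_affineChain]
  refine map_mem_of_supportedOn _ _ (fun w hw ↦ ?_) (iterate_subdiv_mem_supportedOn_dist_le n k)
  rw [affineChain_single]
  -- The whole affine simplex stays within δ of its vertex `w 0`, because all its vertices do.
  obtain ⟨i, hi⟩ := hball (w 0) (Set.mem_univ _)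
  refine singularChain_mem_smallChains ⟨i, fun t ↦ hi ?_⟩
  rw [Metric.mem_ball, dist_comm]
  exact (dist_affineMap_le _ _ w (hw 0) t).trans_lt hlt

/-- Asking for all large k, not just one, lets sums of simplices use the maximum of their bounds. -/
lemma exists_iterate_singularSubdiv (hc : ∀ i, IsOpen (c i)) (hcov : ⋃ i, c i = Set.univ) {n : ℕ}
    (s : X.singularChains.X n) :
    ∃ k₀, ∀ k ≥ k₀, (singularSubdiv X n)^[k] s ∈ smallChains c n := by
  have hs : s ∈ AddSubgroup.closure
      (Set.range (chainOf : (toSSet.obj X) _⦋n⦌ → X.singularChains.X n)) := by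
    rw [closure_chainOf]
    trivial
  induction hs using AddSubgroup.closure_induction with
  | mem x hx =>
    obtain ⟨y, rfl⟩ := hx
    obtain ⟨σ, rfl⟩ := singularSimplex_surjective y
    exact exists_iterate_singularSubdiv_singularChain hc hcov σ
  | zero => exact ⟨0, fun k _ ↦ by rw [iterate_map_zero]; exact zero_mem _⟩
  | add x y _ _ hx hy =>
    obtain ⟨k, hk⟩ := hx
    obtain ⟨l, hl⟩ := hy
    refine ⟨max k l, fun m hm ↦ ?_⟩
    rw [iterate_map_add]
    exact add_mem (hk m (le_of_max_le_left hm)) (hl m (le_of_max_le_right hm))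
  | neg x _ hx =>
    obtain ⟨k, hk⟩ := hx
    refine ⟨k, fun m hm ↦ ?_⟩
    rw [iterate_map_neg]
    exact neg_mem (hk m hm)

/-- A chain with small boundary is small up to a boundary. -/
lemma exists_sub_boundary_mem_smallChains (hc : ∀ i, IsOpen (c i)) (hcov : ⋃ i, c i = Set.univ)
    {n : ℕ} (s : X.singularChains.X (n + 1)) (hs : singularD X n s ∈ smallChains c n) :
    ∃ w, s - singularD X (n + 1) w ∈ smallChains c (n + 1) := by
  obtain ⟨k, hk⟩ := exists_iterate_singularSubdiv hc hcov s
  replace hk := hk k le_rfl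
  induction k generalizing s with
  | zero => exact ⟨0, by simpa using hk⟩
  | succ k ih =>
    obtain ⟨w, hw⟩ := ih (singularSubdiv X (n + 1) s)
      (by rw [d_singularSubdiv]; exact singularSubdiv_mem_smallChains hs) hk
    -- With S the subdivision and D the homotopy, s - ∂(w + D s) = (S s - ∂w) + D∂s. The first term
    -- is small by induction on the number of subdivisions, the second since ∂s is small.
    refine ⟨w + singularSubdivHomotopy X (n + 1) s, ?_⟩
    have h := d_singularSubdivHomotopy n s
    have : s - singularD X (n + 1) (w + singularSubdivHomotopy X (n + 1) s) =
        (singularSubdiv X (n + 1) s - singularD X (n + 1) w) +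
          singularSubdivHomotopy X n (singularD X n s) := by
      rw [map_add, eq_sub_of_add_eq h]
      abel
    rw [this]
    exact add_mem hw (singularSubdivHomotopy_mem_smallChains hs)

/-- A 0-simplex is a single point, so no subdivision is needed in degree zero. -/
lemma smallChains_zero (hcov : ⋃ i, c i = Set.univ) : smallChains c 0 = ⊤ := by
  rw [eq_top_iff, ← closure_chainOf, AddSubgroup.closure_le]
  rintro _ ⟨y, rfl⟩
  obtain ⟨σ, rfl⟩ := singularSimplex_surjective y
  obtain ⟨i, hi⟩ := Set.mem_iUnion.1 (hcov.symm ▸ Set.mem_univ (σ default) :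
    σ default ∈ ⋃ i, c i)
  exact singularChain_mem_smallChains ⟨i, fun t ↦ by rwa [Subsingleton.elim t default]⟩

end TopCat

end

section

open CategoryTheory Simplicial Opposite Limits

/-! ### The Mayer-Vietoris sequence of a pushout square of complexes -/

namespace ChainComplex

open HomologicalComplex

variable {K₁ K₂ K₃ K₄ : ChainComplex (ModuleCat.{0} ℤ) ℕ} {t : K₁ ⟶ K₂} {l : K₁ ⟶ K₃}
  {r : K₂ ⟶ K₄} {b : K₃ ⟶ K₄}

/-- A pushout square is right exact as a sequence K₁ → K₂ ⊞ K₃ → K₄; the first map is mono because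
its first component is. -/
lemma shortExact_of_isPushout (sq : IsPushout t l r b) [Mono t] : sq.shortComplex.ShortExact where
  exact := sq.exact_shortComplex
  mono_f := by
    have : Mono (biprod.lift t (-l)) := mono_of_mono_fac (biprod.lift_fst t (-l))
    exact this
  epi_g := sq.epi_shortComplex_g

lemma homologyMap_comp_apply {K L M : ChainComplex (ModuleCat.{0} ℤ) ℕ} (f : K ⟶ L) (g : L ⟶ M)
    (n : ℕ) (x : K.homology n) :
    (homologyMap (f ≫ g) n).hom x = (homologyMap g n).hom ((homologyMap f n).hom x) := by
  rw [homologyMap_comp]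
  rfl

lemma exact_biprod_desc (sq : IsPushout t l r b) [Mono t] (n : ℕ)
    (x : (K₂ ⊞ K₃ : ChainComplex (ModuleCat.{0} ℤ) ℕ).homology n)
    (hx : (homologyMap (biprod.desc r b) n).hom x = 0) :
    ∃ y : K₁.homology n, (homologyMap (biprod.lift t (-l)) n).hom y = x :=
  (ShortComplex.moduleCat_exact_iff _).1 ((shortExact_of_isPushout sq).homology_exact₂ n) x hx

lemma exists_of_homologyMap_eq (sq : IsPushout t l r b) [Mono t] (n : ℕ) (x₂ : K₂.homology n)
    (x₃ : K₃.homology n) (h : (homologyMap r n).hom x₂ = (homologyMap b n).hom x₃) :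
    ∃ x₁ : K₁.homology n, (homologyMap t n).hom x₁ = x₂ ∧ (homologyMap l n).hom x₁ = x₃ := by
  -- The pair (x₂, -x₃) is used because the map out of K₁ has components t and -l.
  obtain ⟨x₁, hx₁⟩ := exact_biprod_desc sq n
    ((homologyMap (biprod.inl : K₂ ⟶ K₂ ⊞ K₃) n).hom x₂ -
      (homologyMap (biprod.inr : K₃ ⟶ K₂ ⊞ K₃) n).hom x₃) (by
      rw [map_sub, ← homologyMap_comp_apply, ← homologyMap_comp_apply, biprod.inl_desc,
        biprod.inr_desc, h, sub_self])
  refine ⟨x₁, ?_, ?_⟩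
  · have := congrArg (homologyMap (biprod.fst : K₂ ⊞ K₃ ⟶ K₂) n).hom hx₁
    rw [map_sub, ← homologyMap_comp_apply, ← homologyMap_comp_apply, ← homologyMap_comp_apply,
      biprod.lift_fst, biprod.inl_fst, biprod.inr_fst, homologyMap_id, homologyMap_zero] at this
    simpa using this
  · have := congrArg (homologyMap (biprod.snd : K₂ ⊞ K₃ ⟶ K₃) n).hom hx₁
    rw [map_sub, ← homologyMap_comp_apply, ← homologyMap_comp_apply, ← homologyMap_comp_apply,
      biprod.lift_snd, biprod.inl_snd, biprod.inr_snd, homologyMap_id, homologyMap_zero,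
      homologyMap_neg] at this
    simpa using this

lemma exists_biprod_connecting (sq : IsPushout t l r b) [Mono t] (n : ℕ) :
    ∃ δ : K₄.homology (n + 1) ⟶ K₁.homology n,
      (∀ x, δ.hom x = 0 ↔ ∃ y : (K₂ ⊞ K₃ : ChainComplex (ModuleCat.{0} ℤ) ℕ).homology (n + 1),
        (homologyMap (biprod.desc r b) (n + 1)).hom y = x) ∧
      ∀ x, (∃ y, δ.hom y = x) ↔ (homologyMap (biprod.lift t (-l)) n).hom x = 0 := by
  have hS := shortExact_of_isPushout sq
  refine ⟨hS.δ (n + 1) n rfl, fun x ↦ ⟨?_, ?_⟩, fun x ↦ ⟨?_, ?_⟩⟩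
  · exact (ShortComplex.moduleCat_exact_iff _).1 (hS.homology_exact₃ (n + 1) n rfl) x
  · rintro ⟨y, rfl⟩
    exact congr(($(hS.comp_δ (n + 1) n rfl)).hom y)
  · rintro ⟨y, rfl⟩
    exact congr(($(hS.δ_comp (n + 1) n rfl)).hom y)
  · exact (ShortComplex.moduleCat_exact_iff _).1 (hS.homology_exact₁ (n + 1) n rfl) x

/-- Componentwise form of the preceding exactness statements. The projections and inclusions of the
biproduct suffice; its homology need not be identified with a product. -/
lemma exists_connecting (sq : IsPushout t l r b) [Mono t] (n : ℕ) :
    ∃ δ : K₄.homology (n + 1) ⟶ K₁.homology n,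
      (∀ x, δ.hom x = 0 ↔ ∃ x₂ x₃, (homologyMap r (n + 1)).hom x₂ +
        (homologyMap b (n + 1)).hom x₃ = x) ∧
      ∀ x, (∃ y, δ.hom y = x) ↔ (homologyMap t n).hom x = 0 ∧ (homologyMap l n).hom x = 0 := by
  obtain ⟨δ, h₁, h₂⟩ := exists_biprod_connecting sq n
  refine ⟨δ, fun x ↦ (h₁ x).trans ⟨?_, ?_⟩, fun x ↦ (h₂ x).trans ⟨fun h0 ↦ ⟨?_, ?_⟩, ?_⟩⟩
  · rintro ⟨y, rfl⟩
    refine ⟨(homologyMap (biprod.fst : K₂ ⊞ K₃ ⟶ K₂) (n + 1)).hom y,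
      (homologyMap (biprod.snd : K₂ ⊞ K₃ ⟶ K₃) (n + 1)).hom y, ?_⟩
    rw [← homologyMap_comp_apply, ← homologyMap_comp_apply, ← LinearMap.add_apply,
      ← ModuleCat.hom_add, ← homologyMap_add, ← biprod.desc_eq]
  · rintro ⟨x₂, x₃, rfl⟩
    refine ⟨(homologyMap (biprod.inl : K₂ ⟶ K₂ ⊞ K₃) (n + 1)).hom x₂ +
      (homologyMap (biprod.inr : K₃ ⟶ K₂ ⊞ K₃) (n + 1)).hom x₃, ?_⟩
    rw [map_add, ← homologyMap_comp_apply, ← homologyMap_comp_apply, biprod.inl_desc,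
      biprod.inr_desc]
  · have := congrArg (homologyMap (biprod.fst : K₂ ⊞ K₃ ⟶ K₂) n).hom h0
    rwa [← homologyMap_comp_apply, biprod.lift_fst, map_zero] at this
  · have := congrArg (homologyMap (biprod.snd : K₂ ⊞ K₃ ⟶ K₃) n).hom h0
    rw [← homologyMap_comp_apply, biprod.lift_snd, map_zero, homologyMap_neg] at this
    simpa using this
  · rintro ⟨ht, hl⟩
    rw [biprod.lift_eq, homologyMap_add, homologyMap_comp, homologyMap_comp, homologyMap_neg]
    simp [ht, hl]

end ChainComplex

end

section

open CategoryTheory Simplicial Opposite Limits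

/-! ### The Mayer-Vietoris sequence of two open subspaces -/

namespace SSet

/-- In each degree the functor is evaluation followed by the formation of copowers of `R`, and both
preserve colimits. Pushouts of simplicial sets thus give pushouts of complexes. -/
instance preservesColimitsOfShape_chainComplexFunctor (J : Type) [Category.{0} J] (R : ModuleCat.{0} ℤ) :
    PreservesColimitsOfShape J ((SSet.chainComplexFunctor (ModuleCat.{0} ℤ)).obj R) := by
  refine HomologicalComplex.preservesColimitsOfShape_of_eval _ fun n ↦ ?_
  change PreservesColimitsOfShape J
    ((CategoryTheory.evaluation _ _).obj (op ⦋n⦌) ⋙ sigmaConst.obj R)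
  infer_instance

instance preservesMonomorphisms_chainComplexFunctor (R : ModuleCat.{0} ℤ) :
    ((SSet.chainComplexFunctor (ModuleCat.{0} ℤ)).obj R).PreservesMonomorphisms where
  preserves f _ := by
    dsimp [SSet.chainComplexFunctor]
    apply +allowSynthFailures Functor.map_mono
    dsimp [SSet, SimplicialObject.whiskering, SimplicialObject]
    infer_instance

variable {X A B W : SSet.{0}} {f : A ⟶ X} {g : B ⟶ X} {p : W ⟶ A} {q : W ⟶ B}

/-- The square of the intersection and the union of two subobjects is a pushout. -/
lemma isPushout_range_sup [Mono f] [Mono g] [Mono p] (w : p ≫ f = q ≫ g)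
    (h : Subcomplex.range f ⊓ Subcomplex.range g ≤ Subcomplex.range (p ≫ f)) :
    IsPushout p q
      (Subcomplex.toRange f ≫ Subcomplex.homOfLE
        (le_sup_left : _ ≤ Subcomplex.range f ⊔ Subcomplex.range g))
      (Subcomplex.toRange g ≫ Subcomplex.homOfLE
        (le_sup_right : _ ≤ Subcomplex.range f ⊔ Subcomplex.range g)) := by
  have hle : Subcomplex.range (p ≫ f) ≤ Subcomplex.range f ⊓ Subcomplex.range g := by
    refine le_inf ?_ ?_
    · rintro n _ ⟨x, rfl⟩
      exact ⟨p.app n x, rfl⟩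
    · rw [w]
      rintro n _ ⟨x, rfl⟩
      exact ⟨q.app n x, rfl⟩
  have sq : Subcomplex.BicartSq (Subcomplex.range (p ≫ f)) (Subcomplex.range f)
      (Subcomplex.range g) (Subcomplex.range f ⊔ Subcomplex.range g) :=
    ⟨rfl, le_antisymm h hle⟩
  refine sq.isPushout.of_iso' (asIso (Subcomplex.toRange (p ≫ f))) (asIso (Subcomplex.toRange f))
    (asIso (Subcomplex.toRange g)) (Iso.refl _) ?_ ?_ ?_ ?_
  · rfl
  · rw [← cancel_mono (Subcomplex.range g).ι]
    exact w
  · rfl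
  · rfl

lemma isPushout_chainComplexMap [Mono f] [Mono g] [Mono p] (w : p ≫ f = q ≫ g)
    (h : Subcomplex.range f ⊓ Subcomplex.range g ≤ Subcomplex.range (p ≫ f))
    (R : ModuleCat.{0} ℤ) :
    IsPushout (chainComplexMap p R) (chainComplexMap q R)
      (chainComplexMap (Subcomplex.toRange f ≫ Subcomplex.homOfLE
        (le_sup_left : _ ≤ Subcomplex.range f ⊔ Subcomplex.range g)) R)
      (chainComplexMap (Subcomplex.toRange g ≫ Subcomplex.homOfLE
        (le_sup_right : _ ≤ Subcomplex.range f ⊔ Subcomplex.range g)) R) :=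
  (isPushout_range_sup w h).map _

end SSet

namespace ChainComplex

open HomologicalComplex

/-- A monomorphism of complexes is a quasi-isomorphism if every chain with boundary in the
subcomplex is in the subcomplex up to a boundary. -/
lemma isIso_homologyMap_of_mono {K L : ChainComplex (ModuleCat.{0} ℤ) ℕ} (f : K ⟶ L) [Mono f]
    (h₀ : ∀ s : L.X 0, ∃ x, (f.f 0).hom x = s)
    (h : ∀ n (s : L.X (n + 1)) (x : K.X n), (L.d (n + 1) n).hom s = (f.f n).hom x →
      ∃ (w : L.X (n + 2)) (y : K.X (n + 1)), s - (L.d (n + 2) (n + 1)).hom w = (f.f (n + 1)).hom y)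
    (n : ℕ) : IsIso (homologyMap f n) := by
  let S := ShortComplex.mk f (cokernel.π f) (cokernel.condition f)
  have hS : S.ShortExact := { exact := ShortComplex.exact_of_g_is_cokernel _ (cokernelIsCokernel f) }
  have hsurj (n : ℕ) : Function.Surjective ((cokernel.π f).f n).hom :=
    (ModuleCat.epi_iff_surjective _).1 inferInstance
  have hker (n : ℕ) (s : L.X n) (hs : ((cokernel.π f).f n).hom s = 0) :
      ∃ x, (f.f n).hom x = s :=
    (ShortComplex.moduleCat_exact_iff _).1
      ((hS.map_of_exact (HomologicalComplex.eval _ _ n)).exact) s hs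
  have hcomp (n : ℕ) (x : K.X n) : ((cokernel.π f).f n).hom ((f.f n).hom x) = 0 :=
    congr(($(cokernel.condition f).f n).hom x)
  have hd (i j : ℕ) (s : L.X i) : ((cokernel f).d i j).hom (((cokernel.π f).f i).hom s) =
      ((cokernel.π f).f j).hom ((L.d i j).hom s) :=
    congr(($((cokernel.π f).comm i j)).hom s)
  -- The hypotheses say precisely that the cokernel is acyclic: it vanishes in degree zero, and `h`
  -- bounds its cycles in higher degrees. The long exact sequence then gives the isomorphism.
  have hQ (n : ℕ) : (cokernel f).ExactAt n := by
    cases n with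
    | zero =>
      rw [exactAt_iff' _ 1 0 0 (by simp) (by simp), ShortComplex.moduleCat_exact_iff]
      intro x _
      obtain ⟨s, rfl⟩ := hsurj 0 x
      obtain ⟨x, rfl⟩ := h₀ s
      exact ⟨0, by rw [map_zero]; exact (hcomp 0 x).symm⟩
    | succ n =>
      rw [exactAt_iff' _ (n + 2) (n + 1) n (by simp) (by simp), ShortComplex.moduleCat_exact_iff]
      intro x hx
      obtain ⟨s, rfl⟩ := hsurj (n + 1) x
      obtain ⟨x, hx⟩ := hker n _ ((hd _ _ s).symm.trans hx)
      obtain ⟨w, y, hy⟩ := h n s x hx.symm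
      refine ⟨((cokernel.π f).f (n + 2)).hom w, (hd _ _ w).trans ?_⟩
      rw [eq_comm, ← sub_eq_zero, ← map_sub, hy]
      exact hcomp _ y
  have hz (n : ℕ) : IsZero (S.X₃.homology n) := (hQ n).isZero_homology
  have : Mono (homologyMap f n) := (hS.homology_exact₁ (n + 1) n rfl).mono_g
    ((hz (n + 1)).eq_of_src _ _)
  have : Epi (homologyMap f n) := (hS.homology_exact₂ n).epi_f ((hz n).eq_of_tgt _ _)
  exact isIso_of_mono_of_epi _

end ChainComplex

end

/-! ### Homology of simplicial sets and of subspaces -/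

section

open CategoryTheory Simplicial Opposite Limits

namespace SSet

open HomologicalComplex

/-- Integral homology of simplicial sets. -/
noncomputable abbrev intHomology (n : ℕ) (X : SSet.{0}) : ModuleCat.{0} ℤ :=
  X.intChains.homology n

/-- The map induced in integral homology by a map of simplicial sets. -/
noncomputable def intHomologyMap (n : ℕ) {X Y : SSet.{0}} (f : X ⟶ Y) :
    intHomology n X →ₗ[ℤ] intHomology n Y :=
  (homologyMap (chainComplexMap f (ModuleCat.of ℤ ℤ)) n).hom

variable {X A B W : SSet.{0}} {f : A ⟶ X} {g : B ⟶ X} {p : W ⟶ A} {q : W ⟶ B}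

lemma intHomologyMap_comp_apply (n : ℕ) (p : W ⟶ A) (f : A ⟶ X) (a : intHomology n W) :
    intHomologyMap n (p ≫ f) a = intHomologyMap n f (intHomologyMap n p a) := by
  rw [intHomologyMap, intHomologyMap, intHomologyMap, ← ChainComplex.homologyMap_comp_apply,
    ← Functor.map_comp]

/-- Exactness of the Mayer-Vietoris sequence at the sum of the homology groups of two
simplicial subsets. -/
lemma exists_of_intHomologyMap_eq [Mono f] [Mono g] [Mono p] (w : p ≫ f = q ≫ g)
    (h : Subcomplex.range f ⊓ Subcomplex.range g ≤ Subcomplex.range (p ≫ f)) (n : ℕ)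
    (hX : Function.Bijective (intHomologyMap n (Subcomplex.range f ⊔ Subcomplex.range g).ι))
    (a : intHomology n A) (b : intHomology n B)
    (hab : intHomologyMap n f a = intHomologyMap n g b) :
    ∃ c, intHomologyMap n p c = a ∧ intHomologyMap n q c = b := by
  refine ChainComplex.exists_of_homologyMap_eq (isPushout_chainComplexMap w h (ModuleCat.of ℤ ℤ))
    n a b (hX.1 ?_)
  refine (intHomologyMap_comp_apply n _ _ a).symm.trans (Eq.trans ?_
    (intHomologyMap_comp_apply n _ _ b))
  exact hab

/-- The connecting homomorphism of the Mayer-Vietoris sequence of two simplicial subsets. -/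
lemma exists_intHomology_connecting [Mono f] [Mono g] [Mono p] (w : p ≫ f = q ≫ g)
    (h : Subcomplex.range f ⊓ Subcomplex.range g ≤ Subcomplex.range (p ≫ f)) (n : ℕ)
    (hX : Function.Bijective (intHomologyMap (n + 1) (Subcomplex.range f ⊔ Subcomplex.range g).ι)) :
    ∃ δ : intHomology (n + 1) X →ₗ[ℤ] intHomology n W,
      (∀ x, δ x = 0 ↔ ∃ a b, intHomologyMap (n + 1) f a + intHomologyMap (n + 1) g b = x) ∧
      ∀ y, (∃ x, δ x = y) ↔ intHomologyMap n p y = 0 ∧ intHomologyMap n q y = 0 := by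
  obtain ⟨δ, h₁, h₂⟩ := ChainComplex.exists_connecting
    (isPushout_chainComplexMap w h (ModuleCat.of ℤ ℤ)) n
  let e := LinearEquiv.ofBijective _ hX
  refine ⟨δ.hom ∘ₗ e.symm.toLinearMap, fun x ↦ (h₁ (e.symm x)).trans ?_,
    fun y ↦ Iff.trans ?_ (h₂ y)⟩
  · refine exists_congr fun a ↦ exists_congr fun b ↦ ?_
    rw [LinearEquiv.eq_symm_apply]
    refine Eq.congr_left ?_
    rw [map_add]
    exact congrArg₂ (· + ·) (intHomologyMap_comp_apply (n + 1) _ _ a).symm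
      (intHomologyMap_comp_apply (n + 1) _ _ b).symm
  · exact (e.symm.surjective.exists (p := fun x ↦ δ.hom x = y)).symm

end SSet

namespace TopCat

open SSet HomologicalComplex

instance {X Y : TopCat.{0}} (f : X ⟶ Y) [Mono f] : Mono (toSSet.map f) :=
  have : toSSet.{0}.IsRightAdjoint := sSetTopAdj.isRightAdjoint
  inferInstance

/-- The inclusion between two subspaces of a topological space. -/
def subspaceInclusion {E : Type} [TopologicalSpace E] {s t : Set E} (h : s ⊆ t) :
    TopCat.of s ⟶ TopCat.of t :=
  TopCat.ofHom ⟨Set.inclusion h, continuous_inclusion h⟩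

instance {E : Type} [TopologicalSpace E] {s t : Set E} (h : s ⊆ t) : Mono (subspaceInclusion h) :=
  (TopCat.mono_iff_injective _).2 (Set.inclusion_injective h)

section

variable {E : Type} [TopologicalSpace E] {s t u v : Set E}

lemma subspaceInclusion_comp (h : s ⊆ t) (h' : t ⊆ u) :
    subspaceInclusion h ≫ subspaceInclusion h' = subspaceInclusion (h.trans h') := rfl

lemma singularSimplex_mem_range_subspaceInclusion (h : s ⊆ t) {n : ℕ}
    (σ : C(_root_.stdSimplex ℝ (Fin (n + 1)), TopCat.of t)) :
    singularSimplex σ ∈ (Subcomplex.range (toSSet.map (subspaceInclusion h))).obj (op ⦋n⦌) ↔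
      ∀ x, (σ x : E) ∈ s := by
  constructor
  · rintro ⟨y, hy⟩ x
    obtain ⟨τ, rfl⟩ := singularSimplex_surjective y
    rw [map_singularSimplex] at hy
    rw [← singularSimplex_injective hy]
    exact (τ x).2
  · intro hσ
    let τ : C(_root_.stdSimplex ℝ (Fin (n + 1)), TopCat.of s) :=
      ⟨fun x ↦ ⟨σ x, hσ x⟩, (continuous_subtype_val.comp σ.continuous).subtype_mk _⟩
    exact ⟨singularSimplex τ, map_singularSimplex _ _⟩

lemma range_subspaceInclusion_inf (h : s ⊆ t) (h' : u ⊆ t) :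
    Subcomplex.range (toSSet.map (subspaceInclusion h)) ⊓
        Subcomplex.range (toSSet.map (subspaceInclusion h')) ≤
      Subcomplex.range (toSSet.map (subspaceInclusion (Set.inter_subset_left : s ∩ u ⊆ s)) ≫
        toSSet.map (subspaceInclusion h)) := by
  rw [← Functor.map_comp, subspaceInclusion_comp]
  intro n x hx
  obtain ⟨m⟩ := n
  induction m using SimplexCategory.rec with | _ m
  obtain ⟨σ, rfl⟩ := singularSimplex_surjective x
  exact (singularSimplex_mem_range_subspaceInclusion _ σ).2 fun x ↦
    ⟨(singularSimplex_mem_range_subspaceInclusion _ σ).1 hx.1 x,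
      (singularSimplex_mem_range_subspaceInclusion _ σ).1 hx.2 x⟩

/-- The bridge between subdivision, which produces small chains, and the pushout argument, which
concerns the simplicial subset generated by the simplices of s and of u. -/
lemma mem_smallChains_iff (h : s ⊆ t) (h' : u ⊆ t) (n : ℕ)
    (x : (TopCat.of t).singularChains.X n) :
    x ∈ smallChains (X := TopCat.of t) (fun i : Bool ↦ Subtype.val ⁻¹' (cond i s u)) n ↔
      ∃ y, ((chainComplexMap (Subcomplex.range (toSSet.map (subspaceInclusion h)) ⊔
        Subcomplex.range (toSSet.map (subspaceInclusion h'))).ι (ModuleCat.of ℤ ℤ)).f n).hom y =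
          x := by
  set L := Subcomplex.range (toSSet.map (subspaceInclusion h)) ⊔
        Subcomplex.range (toSSet.map (subspaceInclusion h'))
  set F := ((chainComplexMap L.ι (ModuleCat.of ℤ ℤ)).f n).hom.toAddMonoidHom
  constructor
  · intro hx
    refine (AddSubgroup.closure_le F.range).2 ?_ hx
    rintro _ ⟨σ, ⟨i, hi⟩, rfl⟩
    have : singularSimplex σ ∈ L.obj (op ⦋n⦌) := by
      cases i with
      | true => exact Or.inl ((singularSimplex_mem_range_subspaceInclusion h σ).2 hi)
      | false => exact Or.inr ((singularSimplex_mem_range_subspaceInclusion h' σ).2 hi)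
    exact ⟨chainOf ⟨_, this⟩, chainMap_chainOf _ _⟩
  · rintro ⟨y, rfl⟩
    have hy : y ∈ AddSubgroup.closure (Set.range (chainOf : L.toSSet _⦋n⦌ → _)) := by
      rw [closure_chainOf]
      trivial
    refine (AddSubgroup.closure_le ((smallChains (X := TopCat.of t)
      (fun i : Bool ↦ Subtype.val ⁻¹' (cond i s u)) n).comap F)).2 ?_ hy
    rintro _ ⟨⟨z, hz⟩, rfl⟩
    obtain ⟨σ, rfl⟩ := singularSimplex_surjective z
    refine (AddSubgroup.mem_comap).2 ?_
    have : F (chainOf (⟨singularSimplex σ, hz⟩ : L.toSSet _⦋n⦌)) = singularChain σ :=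
      chainMap_chainOf _ _
    rw [this]
    rcases hz with hz | hz
    · exact singularChain_mem_smallChains
        ⟨true, (singularSimplex_mem_range_subspaceInclusion h σ).1 hz⟩
    · exact singularChain_mem_smallChains
        ⟨false, (singularSimplex_mem_range_subspaceInclusion h' σ).1 hz⟩

/-- Theorem of small chains for two open sets: a chain with small boundary is small up to a
boundary, which is the criterion of `ChainComplex.isIso_homologyMap_of_mono`. -/
lemma bijective_intHomologyMap_range_sup_ι (h : s ⊆ t) (h' : u ⊆ t)
    (hs : IsOpen (Subtype.val ⁻¹' s : Set t)) (hu : IsOpen (Subtype.val ⁻¹' u : Set t))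
    (hcov : t ⊆ s ∪ u) (n : ℕ) :
    Function.Bijective (intHomologyMap n (Subcomplex.range (toSSet.map (subspaceInclusion h)) ⊔
        Subcomplex.range (toSSet.map (subspaceInclusion h'))).ι) := by
  have hc : ∀ i : Bool, IsOpen (Subtype.val ⁻¹' (cond i s u) : Set (TopCat.of t)) := by
    rintro (_ | _)
    exacts [hu, hs]
  have hcov' : ⋃ i : Bool, (Subtype.val ⁻¹' (cond i s u) : Set (TopCat.of t)) = Set.univ :=
    Set.eq_univ_of_forall fun x ↦ Set.mem_iUnion.2 <| by
      rcases hcov x.2 with hx | hx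
      exacts [⟨true, hx⟩, ⟨false, hx⟩]
  refine (ConcreteCategory.isIso_iff_bijective _).1
    (ChainComplex.isIso_homologyMap_of_mono _ (fun x ↦ ?_) (fun n x y hxy ↦ ?_) n)
  · rw [← mem_smallChains_iff, smallChains_zero hcov']
    trivial
  · obtain ⟨w, hw⟩ := exists_sub_boundary_mem_smallChains hc hcov' x
      ((mem_smallChains_iff h h' n _).2 ⟨y, hxy.symm⟩)
    obtain ⟨z, hz⟩ := (mem_smallChains_iff h h' _ _).1 hw
    exact ⟨w, z, hz.symm⟩

/-- The homology of a subspace. -/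
noncomputable abbrev setHomology (n : ℕ) (s : Set E) : ModuleCat.{0} ℤ :=
  intHomology n (toSSet.obj (TopCat.of s))

/-- The map induced in homology by the inclusion of a subspace in another. -/
noncomputable def setHomologyMap (n : ℕ) (h : s ⊆ t) : setHomology n s →ₗ[ℤ] setHomology n t :=
  intHomologyMap n (toSSet.map (subspaceInclusion h))

lemma setHomologyMap_setHomologyMap (n : ℕ) (h : s ⊆ t) (h' : t ⊆ u) (x : setHomology n s) :
    setHomologyMap n h' (setHomologyMap n h x) = setHomologyMap n (h.trans h') x := by
  rw [setHomologyMap, setHomologyMap, setHomologyMap, ← subspaceInclusion_comp h h',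
    Functor.map_comp, intHomologyMap_comp_apply]

/-- Exactness of the Mayer-Vietoris sequence at the sum of the homology groups of two relatively
open subspaces. -/
theorem exists_of_setHomologyMap_eq (h : s ⊆ t) (h' : u ⊆ t)
    (hs : IsOpen (Subtype.val ⁻¹' s : Set t)) (hu : IsOpen (Subtype.val ⁻¹' u : Set t))
    (hcov : t ⊆ s ∪ u) (n : ℕ) (a : setHomology n s) (b : setHomology n u)
    (hab : setHomologyMap n h a = setHomologyMap n h' b) :
    ∃ c : setHomology n (s ∩ u : Set E),
      setHomologyMap n Set.inter_subset_left c = a ∧ setHomologyMap n Set.inter_subset_right c = b :=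
  exists_of_intHomologyMap_eq (by rw [← Functor.map_comp, ← Functor.map_comp]; rfl)
    (range_subspaceInclusion_inf h h') n
    (bijective_intHomologyMap_range_sup_ι h h' hs hu hcov n) a b hab

/-- The connecting homomorphism of the Mayer-Vietoris sequence of two relatively open subspaces. -/
theorem exists_mayerVietoris_connecting (h : s ⊆ t) (h' : u ⊆ t)
    (hs : IsOpen (Subtype.val ⁻¹' s : Set t)) (hu : IsOpen (Subtype.val ⁻¹' u : Set t))
    (hcov : t ⊆ s ∪ u) (n : ℕ) :
    ∃ δ : setHomology (n + 1) t →ₗ[ℤ] setHomology n (s ∩ u : Set E),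
      (∀ x, δ x = 0 ↔ ∃ a b, setHomologyMap (n + 1) h a + setHomologyMap (n + 1) h' b = x) ∧
      ∀ y, (∃ x, δ x = y) ↔ setHomologyMap n Set.inter_subset_left y = 0 ∧
        setHomologyMap n Set.inter_subset_right y = 0 :=
  exists_intHomology_connecting (by rw [← Functor.map_comp, ← Functor.map_comp]; rfl)
    (range_subspaceInclusion_inf h h') n
    (bijective_intHomologyMap_range_sup_ι h h' hs hu hcov (n + 1))

end

end TopCat

end

section

open CategoryTheory Simplicial Opposite Limits
open scoped ContinuousMap

/-! ### Ranks of homology groups -/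

/-- The rank of the kernel of a linear map. -/
noncomputable def LinearMap.kerRank {R M N : Type*} [Ring R] [AddCommGroup M] [Module R M]
    [AddCommGroup N] [Module R N] (f : M →ₗ[R] N) : Cardinal :=
  Module.rank R (LinearMap.ker f)

lemma LinearMap.kerRank_congr {R N : Type*} {M M' : Type} [Ring R] [AddCommGroup M] [Module R M]
    [AddCommGroup M'] [Module R M'] [AddCommGroup N] [Module R N] {f : M →ₗ[R] N}
    {f' : M' →ₗ[R] N} (e : M ≃ₗ[R] M') (h : ∀ x, f' (e x) = f x) : f.kerRank = f'.kerRank := by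
  refine LinearEquiv.rank_eq (e.ofSubmodules _ _ ?_)
  ext y
  rw [Submodule.mem_map_equiv, LinearMap.mem_ker, LinearMap.mem_ker, ← h, e.apply_symm_apply]

lemma LinearMap.rank_eq_kerRank_add_rank {R : Type*} {M N : Type} [CommRing R] [IsDomain R]
    [AddCommGroup M] [Module R M] [AddCommGroup N] [Module R N] {f : M →ₗ[R] N}
    (hf : Function.Surjective f) : Module.rank R M = f.kerRank + Module.rank R N := by
  rw [← LinearMap.rank_range_add_rank_ker f, LinearMap.range_eq_top.2 hf, rank_top, add_comm,
    LinearMap.kerRank]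

namespace TopCat

open SSet

/-- The integral homology of a space. -/
noncomputable abbrev intHomology (n : ℕ) (X : TopCat.{0}) : ModuleCat.{0} ℤ :=
  SSet.intHomology n (toSSet.obj X)

/-- The map induced in integral homology by a continuous map. -/
noncomputable def intHomologyMap (n : ℕ) {X Y : TopCat.{0}} (f : X ⟶ Y) :
    intHomology n X →ₗ[ℤ] intHomology n Y :=
  SSet.intHomologyMap n (toSSet.map f)

variable {X Y Z : TopCat.{0}} (n : ℕ)

lemma intHomologyMap_comp_apply (f : X ⟶ Y) (g : Y ⟶ Z) (a : intHomology n X) :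
    intHomologyMap n (f ≫ g) a = intHomologyMap n g (intHomologyMap n f a) := by
  rw [intHomologyMap, Functor.map_comp, SSet.intHomologyMap_comp_apply]
  rfl

lemma intHomologyMap_id_apply (a : intHomology n X) : intHomologyMap n (𝟙 X) a = a := by
  rw [intHomologyMap, CategoryTheory.Functor.map_id, SSet.intHomologyMap]
  exact congr(($(SSet.homologyMap_id (toSSet.obj X) (ModuleCat.of ℤ ℤ) n)).hom a)

lemma intHomologyMap_eq_of_homotopic {f g : X ⟶ Y} (h : f.hom.Homotopic g.hom) :
    intHomologyMap n f = intHomologyMap n g := by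
  obtain ⟨H⟩ := h
  have := TopCat.Homotopy.congr_homologyMap_singularChainComplexFunctor (f := f) (g := g) H
    (ModuleCat.of ℤ ℤ) n
  exact congr(($this).hom)

/-- A homotopy equivalence induces an isomorphism in homology. -/
noncomputable def intHomologyEquiv (e : X ≃ₕ Y) : intHomology n X ≃ₗ[ℤ] intHomology n Y :=
  LinearEquiv.ofLinearMap (intHomologyMap n (TopCat.ofHom e.toFun))
    (intHomologyMap n (TopCat.ofHom e.invFun))
    (LinearMap.ext fun a ↦ by
      rw [LinearMap.comp_apply, ← intHomologyMap_comp_apply,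
        intHomologyMap_eq_of_homotopic n (f := ofHom e.invFun ≫ ofHom e.toFun) (g := 𝟙 Y)
          e.right_inv, intHomologyMap_id_apply]
      rfl)
    (LinearMap.ext fun a ↦ by
      rw [LinearMap.comp_apply, ← intHomologyMap_comp_apply,
        intHomologyMap_eq_of_homotopic n (f := ofHom e.toFun ≫ ofHom e.invFun) (g := 𝟙 X)
          e.left_inv, intHomologyMap_id_apply]
      rfl)

/-- The one-point space. -/
abbrev point : TopCat.{0} := TopCat.of PUnit.{1}

/-- The augmentation, from the homology of a space to that of a point. -/
noncomputable def augmentation (X : TopCat.{0}) : intHomology n X →ₗ[ℤ] intHomology n point :=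
  intHomologyMap n (toPoint X)

lemma augmentation_intHomologyMap (f : X ⟶ Y) (a : intHomology n X) :
    augmentation n Y (intHomologyMap n f a) = augmentation n X a := by
  rw [augmentation, ← intHomologyMap_comp_apply]
  rfl

lemma surjective_augmentation [Nonempty X] : Function.Surjective (augmentation n X) := by
  obtain ⟨x⟩ := ‹Nonempty X›
  let i : point ⟶ X := TopCat.ofHom (ContinuousMap.const _ x)
  intro a
  refine ⟨intHomologyMap n i a, ?_⟩
  rw [augmentation_intHomologyMap]
  exact intHomologyMap_id_apply n a

lemma bijective_augmentation [ContractibleSpace X] : Function.Bijective (augmentation n X) := by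
  obtain ⟨e⟩ := (ContractibleSpace.hequiv X PUnit.{1})
  have : augmentation n X = intHomologyEquiv n (Y := point) e := by
    change intHomologyMap n _ = intHomologyMap n _
    congr 1
  rw [this]
  exact (intHomologyEquiv n (Y := point) e).bijective

/-- The rank of integral homology. -/
noncomputable def homologyRank (n : ℕ) (X : TopCat.{0}) : Cardinal := Module.rank ℤ (intHomology n X)

/-- The rank of reduced integral homology. -/
noncomputable def reducedRank (n : ℕ) (X : TopCat.{0}) : Cardinal :=
  (augmentation n X).kerRank

lemma homologyRank_congr (e : X ≃ₕ Y) : homologyRank n X = homologyRank n Y :=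
  (intHomologyEquiv n e).rank_eq

lemma reducedRank_congr (e : X ≃ₕ Y) : reducedRank n X = reducedRank n Y :=
  LinearMap.kerRank_congr (intHomologyEquiv n e) fun x ↦
    augmentation_intHomologyMap n (TopCat.ofHom e.toFun) x

lemma homologyRank_eq_reducedRank_add [Nonempty X] :
    homologyRank n X = reducedRank n X + homologyRank n point :=
  LinearMap.rank_eq_kerRank_add_rank (surjective_augmentation n)

lemma homologyRank_of_contractible [ContractibleSpace X] :
    homologyRank n X = homologyRank n point :=
  LinearEquiv.rank_eq (LinearEquiv.ofBijective _ (bijective_augmentation n))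

lemma subsingleton_intHomology_of_totallyDisconnected [TotallyDisconnectedSpace X] :
    Subsingleton (intHomology (n + 1) X) :=
  ModuleCat.subsingleton_of_isZero
    (AlgebraicTopology.isZero_singularHomologyFunctor_of_totallyDisconnectedSpace
      (ModuleCat.{0} ℤ) (n + 1) (ModuleCat.of ℤ ℤ) X n.succ_ne_zero)

open Classical in
/-- The homology in degree zero of a totally disconnected space is free. -/
noncomputable def intHomologyZeroEquiv (X : TopCat.{0}) [TotallyDisconnectedSpace X] :
    intHomology 0 X ≃ₗ[ℤ] DirectSum X fun _ ↦ ℤ :=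
  ((AlgebraicTopology.singularHomologyFunctorZeroOfTotallyDisconnectedSpace
      (ModuleCat.{0} ℤ) (ModuleCat.of ℤ ℤ) X) ≪≫
    ModuleCat.coprodIsoDirectSum fun _ : X ↦ ModuleCat.of ℤ ℤ).toLinearEquiv

lemma homologyRank_zero_point : homologyRank 0 point = 1 := by
  rw [homologyRank, (intHomologyZeroEquiv point).rank_eq, rank_directSum]
  simp

/-- Ranks are cardinals, so the final count can cancel this term only because it is finite. -/
lemma homologyRank_point_lt_aleph0 : homologyRank n point < Cardinal.aleph0 := by
  cases n with
  | zero => rw [homologyRank_zero_point]; exact Cardinal.one_lt_aleph0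
  | succ n =>
    have := subsingleton_intHomology_of_totallyDisconnected (X := point) n
    rw [homologyRank, rank_subsingleton']
    exact Cardinal.aleph0_pos

lemma subsingleton_intHomology_of_isEmpty [IsEmpty X] : Subsingleton (intHomology n X) := by
  have : TotallyDisconnectedSpace X := ⟨fun _ _ _ x ↦ isEmptyElim x⟩
  cases n with
  | zero => exact (intHomologyZeroEquiv X).injective.subsingleton
  | succ n => exact subsingleton_intHomology_of_totallyDisconnected n

end TopCat

end

/-! ### Rank counts and additivity over separated pieces -/

section

open CategoryTheory Simplicial Opposite Limits
open scoped ContinuousMap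

lemma rank_prod_of_isDomain {R : Type*} {M N : Type} [CommRing R] [IsDomain R] [AddCommGroup M]
    [Module R M] [AddCommGroup N] [Module R N] :
    Module.rank R (M × N) = Module.rank R M + Module.rank R N := by
  rw [← LinearMap.rank_range_add_rank_ker (LinearMap.fst R M N), LinearMap.range_eq_top.2
    LinearMap.fst_surjective, rank_top, LinearMap.ker_fst,

    ← (LinearEquiv.ofInjective (LinearMap.inr R M N) LinearMap.inr_injective).rank_eq]

/-- The count of ranks in an exact sequence `0 → K → M × N → P`. -/
lemma LinearMap.rank_add_rank_eq {R : Type*} {K M N P : Type} [CommRing R] [IsDomain R]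
    [AddCommGroup K] [Module R K] [AddCommGroup M] [Module R M] [AddCommGroup N] [Module R N]
    [AddCommGroup P] [Module R P] (p : K →ₗ[R] M) (q : K →ₗ[R] N) (f : M →ₗ[R] P) (g : N →ₗ[R] P)
    (hpq : ∀ c, p c = 0 → q c = 0 → c = 0) (h : ∀ c, f (p c) = g (q c))
    (hfg : ∀ a b, f a = g b → ∃ c, p c = a ∧ q c = b) :
    Module.rank R M + Module.rank R N = Module.rank R K +
      Module.rank R (LinearMap.range f ⊔ LinearMap.range g : Submodule R P) := by
  -- Rank-nullity for (a, b) ↦ f a - g b: its kernel is the embedded copy of `K`.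
  have hr : LinearMap.range (f.coprod (-g)) = LinearMap.range f ⊔ LinearMap.range g := by
    rw [LinearMap.range_coprod, LinearMap.range_neg]
  have hk : LinearMap.ker (f.coprod (-g)) = LinearMap.range (p.prod q) := by
    ext ⟨a, b⟩
    rw [LinearMap.mem_ker, LinearMap.coprod_apply, LinearMap.neg_apply, ← sub_eq_add_neg,
      sub_eq_zero]
    constructor
    · intro hab
      obtain ⟨c, rfl, rfl⟩ := hfg a b hab
      exact ⟨c, rfl⟩
    · rintro ⟨c, hc⟩
      rw [← show p c = a from congrArg Prod.fst hc, ← show q c = b from congrArg Prod.snd hc]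
      exact h c
  have hinj : Function.Injective (p.prod q) := by
    refine (injective_iff_map_eq_zero _).2 fun c hc ↦ ?_
    exact hpq c (congrArg Prod.fst hc) (congrArg Prod.snd hc)
  rw [← rank_prod_of_isDomain, ← LinearMap.rank_range_add_rank_ker (f.coprod (-g)), hr, hk,
    ← (LinearEquiv.ofInjective _ hinj).rank_eq, add_comm]

namespace ChainComplex

open HomologicalComplex

/-- In degree zero every chain is a cycle, so homology is a quotient of the chains. This gives the
surjective end of the Mayer-Vietoris sequence. -/
lemma epi_homologyMap_zero {K L : ChainComplex (ModuleCat.{0} ℤ) ℕ} (f : K ⟶ L) [Epi (f.f 0)] :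
    Epi (homologyMap f 0) := by
  have : homologyMap f 0 = K.homologyι 0 ≫ opcyclesMap f 0 ≫ inv (L.homologyι 0) := by
    rw [← Category.assoc, IsIso.eq_comp_inv, homologyι_naturality]
  rw [this]
  infer_instance

lemma exists_homologyMap_zero_add_eq {K₁ K₂ K₃ K₄ : ChainComplex (ModuleCat.{0} ℤ) ℕ}
    {t : K₁ ⟶ K₂} {l : K₁ ⟶ K₃} {r : K₂ ⟶ K₄} {b : K₃ ⟶ K₄} (sq : IsPushout t l r b)
    {n : ℕ} (hn : n = 0) (x : K₄.homology n) :
    ∃ x₂ x₃, (homologyMap r n).hom x₂ + (homologyMap b n).hom x₃ = x := by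
  subst hn
  have : Epi (biprod.desc r b) := sq.epi_shortComplex_g
  have := epi_homologyMap_zero (biprod.desc r b)
  obtain ⟨y, rfl⟩ := (ModuleCat.epi_iff_surjective _).1 this x
  refine ⟨(homologyMap (biprod.fst : K₂ ⊞ K₃ ⟶ K₂) 0).hom y,
    (homologyMap (biprod.snd : K₂ ⊞ K₃ ⟶ K₃) 0).hom y, ?_⟩
  rw [← homologyMap_comp_apply, ← homologyMap_comp_apply, ← LinearMap.add_apply,
    ← ModuleCat.hom_add, ← homologyMap_add, ← biprod.desc_eq]

end ChainComplex

namespace SSet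

variable {X A B W : SSet.{0}} {f : A ⟶ X} {g : B ⟶ X} {p : W ⟶ A} {q : W ⟶ B}

lemma exists_intHomologyMap_zero_add_eq [Mono f] [Mono g] [Mono p] (w : p ≫ f = q ≫ g)
    (h : Subcomplex.range f ⊓ Subcomplex.range g ≤ Subcomplex.range (p ≫ f)) {n : ℕ} (hn : n = 0)
    (hX : Function.Bijective (intHomologyMap n (Subcomplex.range f ⊔ Subcomplex.range g).ι))
    (x : intHomology n X) : ∃ (a : intHomology n A) (b : intHomology n B),
      intHomologyMap n f a + intHomologyMap n g b = x := by
  obtain ⟨y, hy⟩ := hX.2 x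
  obtain ⟨a, b, hab⟩ := ChainComplex.exists_homologyMap_zero_add_eq
    (isPushout_chainComplexMap w h (ModuleCat.of ℤ ℤ)) hn y
  refine ⟨a, b, ?_⟩
  have ha := intHomologyMap_comp_apply n (Subcomplex.toRange f ≫ Subcomplex.homOfLE
    (le_sup_left : _ ≤ Subcomplex.range f ⊔ Subcomplex.range g)) (Subcomplex.ι _) a
  have hb := intHomologyMap_comp_apply n (Subcomplex.toRange g ≫ Subcomplex.homOfLE
    (le_sup_right : _ ≤ Subcomplex.range f ⊔ Subcomplex.range g)) (Subcomplex.ι _) b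
  rw [← hy, ← hab, map_add]
  exact congrArg₂ (· + ·) ha hb

end SSet

namespace TopCat

open SSet

variable {E : Type} [TopologicalSpace E] {s t u : Set E}

lemma exists_setHomologyMap_zero_add_eq (h : s ⊆ t) (h' : u ⊆ t)
    (hs : IsOpen (Subtype.val ⁻¹' s : Set t)) (hu : IsOpen (Subtype.val ⁻¹' u : Set t))
    (hcov : t ⊆ s ∪ u) {n : ℕ} (hn : n = 0) (x : setHomology n t) :
    ∃ (a : setHomology n s) (b : setHomology n u),
      setHomologyMap n h a + setHomologyMap n h' b = x := by
  have w : toSSet.map (subspaceInclusion (Set.inter_subset_left : s ∩ u ⊆ s)) ≫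
      toSSet.map (subspaceInclusion h) =
    toSSet.map (subspaceInclusion (Set.inter_subset_right : s ∩ u ⊆ u)) ≫
      toSSet.map (subspaceInclusion h') := by
    rw [← Functor.map_comp, ← Functor.map_comp]
    rfl
  exact exists_intHomologyMap_zero_add_eq w (range_subspaceInclusion_inf h h') hn
    (bijective_intHomologyMap_range_sup_ι h h' hs hu hcov n) x

lemma augmentation_setHomologyMap (n : ℕ) (h : s ⊆ t) (a : setHomology n s) :
    augmentation n (TopCat.of t) (setHomologyMap n h a) = augmentation n (TopCat.of s) a :=
  augmentation_intHomologyMap n (subspaceInclusion h) a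

/-- Additivity of the rank of homology for two disjoint relatively open pieces. -/
lemma homologyRank_union_of_disjoint
    (hs : IsOpen (Subtype.val ⁻¹' s : Set (s ∪ u : Set E)))
    (hu : IsOpen (Subtype.val ⁻¹' u : Set (s ∪ u : Set E))) (hd : Disjoint s u) (n : ℕ) :
    homologyRank n (TopCat.of (s ∪ u : Set E)) =
      homologyRank n (TopCat.of s) + homologyRank n (TopCat.of u) := by
  have : IsEmpty (s ∩ u : Set E) := by
    rw [Set.disjoint_iff_inter_eq_empty.1 hd]
    infer_instance
  have h0 (m : ℕ) : Subsingleton (setHomology m (s ∩ u : Set E)) :=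
    subsingleton_intHomology_of_isEmpty (X := TopCat.of (s ∩ u : Set E)) m
  have key := LinearMap.rank_add_rank_eq
    (setHomologyMap n (Set.inter_subset_left : s ∩ u ⊆ s))
    (setHomologyMap n (Set.inter_subset_right : s ∩ u ⊆ u))
    (setHomologyMap n (Set.subset_union_left : s ⊆ s ∪ u))
    (setHomologyMap n (Set.subset_union_right : u ⊆ s ∪ u))
    (fun c _ _ ↦ Subsingleton.elim _ _)
    (fun c ↦ by rw [setHomologyMap_setHomologyMap, setHomologyMap_setHomologyMap])
    (fun a b hab ↦ exists_of_setHomologyMap_eq Set.subset_union_left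
      Set.subset_union_right hs hu subset_rfl n a b hab)
  have htop : LinearMap.range (setHomologyMap n (Set.subset_union_left : s ⊆ s ∪ u)) ⊔
      LinearMap.range (setHomologyMap n (Set.subset_union_right : u ⊆ s ∪ u)) = ⊤ := by
    refine eq_top_iff.2 fun x _ ↦ ?_
    suffices ∃ (a : setHomology n s) (b : setHomology n u),
        setHomologyMap n Set.subset_union_left a + setHomologyMap n Set.subset_union_right b = x by
      obtain ⟨a, b, h⟩ := this
      exact Submodule.mem_sup.2 ⟨_, ⟨a, rfl⟩, _, ⟨b, rfl⟩, h⟩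
    -- In degree zero no connecting map leaves H_n of the union; in positive degree it lands in the
    -- homology of the empty set.
    rcases n.eq_zero_or_pos with hn | hn
    · exact exists_setHomologyMap_zero_add_eq _ _ hs hu subset_rfl hn x
    · obtain ⟨n, rfl⟩ := Nat.exists_eq_succ_of_ne_zero hn.ne'
      obtain ⟨δ, h₁, -⟩ := exists_mayerVietoris_connecting Set.subset_union_left
        Set.subset_union_right hs hu subset_rfl n
      exact (h₁ x).1 (Subsingleton.elim _ _)
  rw [htop, rank_top, rank_subsingleton' ℤ (setHomology n (s ∩ u : Set E)), zero_add] at key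
  exact key.symm

/-- Additivity of the rank of homology for finitely many pieces with separating open
neighbourhoods. -/
lemma homologyRank_biUnion {ι : Type*} (I : Finset ι) (s : ι → Set E) (o : ι → Set E)
    (ho : ∀ i, IsOpen (o i)) (hso : ∀ i, s i ⊆ o i)
    (hd : ∀ i ∈ I, ∀ j ∈ I, i ≠ j → Disjoint (o i) (s j)) (n : ℕ) :
    homologyRank n (TopCat.of (⋃ i ∈ I, s i : Set E)) =
      ∑ i ∈ I, homologyRank n (TopCat.of (s i)) := by
  classical
  induction I using Finset.induction_on with
  | empty =>
    have : IsEmpty (⋃ i ∈ (∅ : Finset ι), s i : Set E) := by simp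
    have := subsingleton_intHomology_of_isEmpty (X := TopCat.of (⋃ i ∈ (∅ : Finset ι), s i : Set E)) n
    rw [Finset.sum_empty, homologyRank, rank_subsingleton']
  | insert a I ha ih =>
    have hda : ∀ i ∈ I, Disjoint (o a) (s i) ∧ Disjoint (o i) (s a) := fun i hi ↦
      ⟨hd _ (by simp) _ (by simp [hi]) (by rintro rfl; exact ha hi),
        hd _ (by simp [hi]) _ (by simp) (by rintro rfl; exact ha hi)⟩
    rw [Finset.sum_insert ha, ← ih fun i hi j hj ↦ hd i (by simp [hi]) j (by simp [hj]),
      Finset.set_biUnion_insert]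
    -- Only `o i` and `s j` need be disjoint for i ≠ j: this makes each piece relatively open in the
    -- union.
    refine homologyRank_union_of_disjoint ⟨o a, ho a, ?_⟩
      ⟨⋃ i ∈ I, o i, isOpen_biUnion fun i _ ↦ ho i, ?_⟩ ?_ n
    · ext ⟨x, hx⟩
      simp only [Set.mem_preimage]
      refine ⟨fun h ↦ hx.resolve_right fun h' ↦ ?_, fun h ↦ hso a h⟩
      obtain ⟨i, hi, hxi⟩ := Set.mem_iUnion₂.1 h'
      exact Set.disjoint_left.1 (hda i hi).1 h hxi
    · ext ⟨x, hx⟩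
      simp only [Set.mem_preimage]
      refine ⟨fun h ↦ hx.resolve_left fun h' ↦ ?_, fun h ↦
        Set.iUnion₂_mono (fun i _ ↦ hso i) h⟩
      obtain ⟨i, hi, hxi⟩ := Set.mem_iUnion₂.1 h
      exact Set.disjoint_left.1 (hda i hi).2 hxi h'
    · rw [Set.disjoint_iUnion₂_right]
      exact fun i hi ↦ (hda i hi).1.mono_left (hso a)

end TopCat

end

/-! ### Homology of punctured vector spaces -/

section

open CategoryTheory Simplicial Opposite Limits
open scoped ContinuousMap

lemma LinearMap.kerRank_of_subsingleton {R M N : Type*} [Ring R] [AddCommGroup M] [Module R M]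
    [AddCommGroup N] [Module R N] [Subsingleton N] (f : M →ₗ[R] N) :
    f.kerRank = Module.rank R M := by
  rw [LinearMap.kerRank, Subsingleton.elim f 0, LinearMap.ker_zero, rank_top]

/-- The rank of the kernel at the end of an exact sequence `0 → M → N → P`. -/
lemma LinearMap.kerRank_eq_rank {R P : Type*} {M N : Type} [Ring R] [AddCommGroup M] [Module R M]
    [AddCommGroup N] [Module R N] [AddCommGroup P] [Module R P] (f : M →ₗ[R] N) (g : N →ₗ[R] P)
    (hf : ∀ x, f x = 0 → x = 0) (h : ∀ y, (∃ x, f x = y) ↔ g y = 0) :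
    g.kerRank = Module.rank R M := by
  have : LinearMap.ker g = LinearMap.range f := by
    ext y
    exact (h y).symm
  rw [LinearMap.kerRank, this]
  exact (LinearEquiv.ofInjective f ((injective_iff_map_eq_zero f).2 hf)).rank_eq.symm

namespace TopCat

open SSet

section

variable {E : Type} [TopologicalSpace E] {s t u : Set E}

/-- The suspension isomorphism. The connecting map is injective since s and u have no homology in
degree n + 1; its image is the kernel of the augmentation since H_n of s and of u is that of a
point. -/
lemma reducedRank_succ_eq_of_contractible (h : s ⊆ t) (h' : u ⊆ t)
    (hs : IsOpen (Subtype.val ⁻¹' s : Set t)) (hu : IsOpen (Subtype.val ⁻¹' u : Set t))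
    (hcov : t ⊆ s ∪ u) [ContractibleSpace s] [ContractibleSpace u] (n : ℕ) :
    reducedRank (n + 1) (TopCat.of t) = reducedRank n (TopCat.of (s ∩ u : Set E)) := by
  have h0 := subsingleton_intHomology_of_totallyDisconnected (X := point) n
  obtain ⟨δ, h₁, h₂⟩ := exists_mayerVietoris_connecting h h' hs hu hcov n
  have hs' (m) : Function.Bijective (augmentation m (TopCat.of s)) :=
    have : ContractibleSpace (TopCat.of s) := ‹ContractibleSpace s›
    bijective_augmentation m
  have hu' (m) : Function.Bijective (augmentation m (TopCat.of u)) :=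
    have : ContractibleSpace (TopCat.of u) := ‹ContractibleSpace u›
    bijective_augmentation m
  have hs0 : Subsingleton (setHomology (n + 1) s) := (hs' _).1.subsingleton
  have hu0 : Subsingleton (setHomology (n + 1) u) := (hu' _).1.subsingleton
  refine (LinearMap.kerRank_of_subsingleton (augmentation (n + 1) (TopCat.of t))).trans
    (LinearMap.kerRank_eq_rank δ (augmentation n (TopCat.of (s ∩ u : Set E))) (fun x hx ↦ ?_)
      fun y ↦ (h₂ y).trans ?_).symm
  · obtain ⟨a, b, rfl⟩ := (h₁ x).1 hx
    rw [Subsingleton.elim a 0, Subsingleton.elim b 0, map_zero, map_zero, add_zero]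
  · rw [← map_eq_zero_iff _ (hs' n).1, ← map_eq_zero_iff _ (hu' n).1,
      augmentation_setHomologyMap, augmentation_setHomologyMap, and_self]

end

section

variable (E : Type) [NormedAddCommGroup E] [NormedSpace ℝ E]

/-- The homotopy equivalence between the complement of the line `0 × ℝ` and the punctured
hyperplane. -/
noncomputable def complLineHomotopyEquiv :
    ({x | x.1 ≠ 0} : Set (E × ℝ)) ≃ₕ ({0}ᶜ : Set E) where
  toFun := ⟨fun x ↦ ⟨x.1.1, x.2⟩, by fun_prop⟩
  invFun := ⟨fun x ↦ ⟨(x.1, 0), x.2⟩, by fun_prop⟩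
  left_inv := ⟨{
    toFun := fun p ↦ ⟨(p.2.1.1, p.1.1 * p.2.1.2), p.2.2⟩
    continuous_toFun := by fun_prop
    map_zero_left := fun x ↦ by simp
    map_one_left := fun x ↦ by simp }⟩
  right_inv := by rfl

/-- The set is the complement of the closed ray from the origin pointing away from (0, c). -/
lemma starConvex_ne_zero_or_pos (c : ℝ) (hc : c ≠ 0) :
    StarConvex ℝ ((0, c) : E × ℝ) {x | x.1 ≠ 0 ∨ 0 < c * x.2} := by
  rintro ⟨x, t⟩ hx a b ha hb hab
  rcases hb.eq_or_lt with rfl | hb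
  · obtain rfl : a = 1 := by linarith
    right
    simpa using mul_self_pos.2 hc
  · rcases hx with hx | hx
    · left
      simpa [hb.ne'] using hx
    · right
      have := mul_self_pos.2 hc
      simp only [Prod.smul_mk, Prod.mk_add_mk, smul_eq_mul] at hx ⊢
      have h1 : c * (a * c + b * t) = a * (c * c) + b * (c * t) := by ring
      rw [h1]
      positivity

/-- The complements of two opposite closed rays are contractible and cover the punctured space. They
meet in the complement of a line, which retracts to the punctured hyperplane. -/
lemma reducedRank_succ_compl_zero (n : ℕ) :
    reducedRank (n + 1) (TopCat.of ({0}ᶜ : Set (E × ℝ))) =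
      reducedRank n (TopCat.of ({0}ᶜ : Set E)) := by
  set U : ℝ → Set (E × ℝ) := fun c ↦ {x | x.1 ≠ 0 ∨ 0 < c * x.2}
  have hU (c : ℝ) : IsOpen (U c) :=
    (isOpen_ne.preimage continuous_fst).union
      (isOpen_lt continuous_const (continuous_const.mul continuous_snd))
  have hsub (c : ℝ) : U c ⊆ ({0}ᶜ : Set (E × ℝ)) := by
    rintro x hx rfl
    rcases hx with hx | hx
    · exact hx rfl
    · simp at hx
  have hcontr (c : ℝ) (hc : c ≠ 0) : ContractibleSpace (U c) :=
    (starConvex_ne_zero_or_pos E c hc).contractibleSpace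
      ⟨(0, c), Or.inr (mul_self_pos.2 hc)⟩
  have := hcontr 1 one_ne_zero
  have := hcontr (-1) (by norm_num)
  rw [reducedRank_succ_eq_of_contractible (hsub 1) (hsub (-1))
    ((hU 1).preimage continuous_subtype_val) ((hU (-1)).preimage continuous_subtype_val) ?_ n]
  · have : U 1 ∩ U (-1) = {x | x.1 ≠ 0} := by
      ext x
      simp only [U, Set.mem_inter_iff, Set.mem_ofPred_eq]
      constructor
      · rintro ⟨h | h, h' | h'⟩ <;> first | assumption | (exfalso; linarith)
      · exact fun h ↦ ⟨Or.inl h, Or.inl h⟩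
    rw [this]
    exact reducedRank_congr n (complLineHomotopyEquiv E)
  · rintro ⟨x, t⟩ hx
    by_cases h : x = 0
    · subst h
      have ht : t ≠ 0 := by
        rintro rfl
        exact hx rfl
      rcases ht.lt_or_gt with ht | ht
      · exact Or.inr (Or.inr (by simpa using ht))
      · exact Or.inl (Or.inr (by simpa using ht))
    · exact Or.inl (Or.inl h)

end

/-- Two contractible half-lines give rank two in degree zero, one of which is the augmentation. -/
lemma reducedRank_zero_compl_zero_real : reducedRank 0 (TopCat.of ({0}ᶜ : Set ℝ)) = 1 := by
  have h : ({0}ᶜ : Set ℝ) = Set.Iio 0 ∪ Set.Ioi 0 := Set.Iio_union_Ioi.symm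
  have h₁ := homologyRank_union_of_disjoint (s := Set.Iio (0 : ℝ)) (u := Set.Ioi 0)
    (isOpen_Iio.preimage continuous_subtype_val) (isOpen_Ioi.preimage continuous_subtype_val)
    (Set.disjoint_left.2 fun x hx hx' ↦ lt_asymm (Set.mem_Iio.1 hx) hx') 0
  have : ContractibleSpace (TopCat.of (Set.Iio (0 : ℝ))) :=
    (convex_Iio (0 : ℝ)).contractibleSpace ⟨-1, by simp⟩
  have : ContractibleSpace (TopCat.of (Set.Ioi (0 : ℝ))) :=
    (convex_Ioi (0 : ℝ)).contractibleSpace ⟨1, by simp⟩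
  have : Nonempty (TopCat.of ({0}ᶜ : Set ℝ)) := ⟨⟨1, by simp⟩⟩
  rw [← h, homologyRank_of_contractible 0 (X := TopCat.of (Set.Iio (0 : ℝ))),
    homologyRank_of_contractible 0 (X := TopCat.of (Set.Ioi (0 : ℝ))), homologyRank_eq_reducedRank_add, homologyRank_zero_point] at h₁
  exact Cardinal.eq_of_add_eq_add_right h₁ Cardinal.one_lt_aleph0

/-- The homology of a punctured vector space. -/
theorem reducedRank_compl_zero (d : ℕ) : ∀ (E : Type) [NormedAddCommGroup E] [NormedSpace ℝ E]
    [FiniteDimensional ℝ E], Module.finrank ℝ E = d + 1 →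
      reducedRank d (TopCat.of ({0}ᶜ : Set E)) = 1 := by
  have key (E F : Type) [NormedAddCommGroup E] [NormedSpace ℝ E] [NormedAddCommGroup F]
      [NormedSpace ℝ F] (e : E ≃L[ℝ] F) (n : ℕ) : reducedRank n (TopCat.of ({0}ᶜ : Set E)) =
      reducedRank n (TopCat.of ({0}ᶜ : Set F)) :=
    reducedRank_congr n (Homeomorph.toHomotopyEquiv (e.toHomeomorph.subtype fun x ↦ by simp))
  induction d with
  | zero =>
    intro E _ _ _ hE
    rw [key E ℝ (ContinuousLinearEquiv.ofFinrankEq (by simpa using hE)) 0]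
    exact reducedRank_zero_compl_zero_real
  | succ d ih =>
    intro E _ _ _ hE
    rw [key E ((Fin (d + 1) → ℝ) × ℝ) (ContinuousLinearEquiv.ofFinrankEq
      (by simpa using hE)), reducedRank_succ_compl_zero]
    exact ih _ (by simp)

end TopCat

end

/-! ### The Mayer-Vietoris rank count -/

section

open CategoryTheory Simplicial Opposite Limits
open scoped ContinuousMap

lemma rank_int_of_finite {M : Type} [AddCommGroup M] [Module ℤ M] [Finite M] :
    Module.rank ℤ M = 0 := by
  refine rank_eq_zero_iff.2 fun x ↦ ?_
  obtain ⟨n, hn, h⟩ := isOfFinAddOrder_iff_nsmul_eq_zero.1 (isOfFinAddOrder_of_finite x)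
  exact ⟨n, by exact_mod_cast hn.ne', by rw [Nat.cast_smul_eq_nsmul, h]⟩

/-- A submodule mapping onto the target of a map with finite kernel has the rank of the target. -/
lemma rank_eq_of_finite_ker {M N : Type} [AddCommGroup M] [Module ℤ M] [AddCommGroup N] [Module ℤ N]
    (f : M →ₗ[ℤ] N) [Finite (LinearMap.ker f)] (R : Submodule ℤ M)
    (hR : ∀ y, ∃ x ∈ R, f x = y) : @Module.rank ℤ R _ _ R.module = Module.rank ℤ N := by
  let := R.module
  let g : R →ₗ[ℤ] N := f ∘ₗ R.subtype
  have hsurj : Function.Surjective g := fun y ↦ by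
    obtain ⟨x, hx, h⟩ := hR y
    exact ⟨⟨x, hx⟩, h⟩
  have : Finite (LinearMap.ker g) :=
    Finite.of_injective (β := LinearMap.ker f) (fun x ↦ ⟨x.1.1, x.2⟩) fun x y h ↦
      Subtype.ext (Subtype.ext (congrArg (fun z ↦ z.1) h))
  have h0 : g.kerRank = 0 :=
    @rank_int_of_finite (LinearMap.ker g) _ (LinearMap.ker g).module _
  exact (LinearMap.rank_eq_kerRank_add_rank hsurj).trans (by rw [h0, zero_add])

namespace TopCat

open SSet

variable {E : Type} [TopologicalSpace E]

/-- The rank of the reduced homology of the complement `U` of `f` discs in a space `X` with trivial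
reduced homology, in terms of the homology of the discs and of the punctured discs. -/
theorem reducedRank_eq_of_isOpen_cover {X U V : Set E} (hUX : U ⊆ X) (hVX : V ⊆ X)
    (hU : IsOpen (Subtype.val ⁻¹' U : Set X)) (hV : IsOpen (Subtype.val ⁻¹' V : Set X))
    (hcov : X ⊆ U ∪ V) [hne : Nonempty U] (j f : ℕ)
    (h₁ : Subsingleton (LinearMap.ker (augmentation (j + 1) (TopCat.of X))))
    (h₀ : Finite (LinearMap.ker (augmentation j (TopCat.of X))))
    (hfV : homologyRank j (TopCat.of V) = f * homologyRank j point)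
    (hfW : homologyRank j (TopCat.of (U ∩ V : Set E)) = f * (1 + homologyRank j point)) :
    reducedRank j (TopCat.of U) = f := by
  have hpt := subsingleton_intHomology_of_totallyDisconnected (X := point) j
  have hX : Subsingleton (setHomology (j + 1) X) :=
    ⟨fun x y ↦ congrArg Subtype.val (h₁.elim ⟨x, Subsingleton.elim _ _⟩ ⟨y, Subsingleton.elim _ _⟩)⟩
  obtain ⟨δ, -, hδ⟩ := exists_mayerVietoris_connecting hUX hVX hU hV hcov j
  have key := LinearMap.rank_add_rank_eq
    (setHomologyMap j (Set.inter_subset_left : U ∩ V ⊆ U))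
    (setHomologyMap j (Set.inter_subset_right : U ∩ V ⊆ V))
    (setHomologyMap j hUX) (setHomologyMap j hVX)
    (fun c hc hc' ↦ by
      obtain ⟨x, rfl⟩ := (hδ c).2 ⟨hc, hc'⟩
      rw [Subsingleton.elim x 0, map_zero])
    (fun c ↦ by rw [setHomologyMap_setHomologyMap, setHomologyMap_setHomologyMap])
    (fun a b hab ↦ exists_of_setHomologyMap_eq hUX hVX hU hV hcov j a b hab)
  -- The last map need not be onto H_j(X). Its image already covers H_j of a point because U is
  -- nonempty, and the finite kernel contributes no rank.
  have hr := rank_eq_of_finite_ker (augmentation j (TopCat.of X))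
    (LinearMap.range (setHomologyMap j hUX) ⊔ LinearMap.range (setHomologyMap j hVX)) fun y ↦ by
      have : Nonempty (TopCat.of U) := hne
      obtain ⟨a, ha⟩ := surjective_augmentation j (X := TopCat.of U) y
      exact ⟨_, Submodule.mem_sup_left ⟨a, rfl⟩, (augmentation_setHomologyMap j hUX a).trans ha⟩
  have hU' : homologyRank j (TopCat.of U) = reducedRank j (TopCat.of U) + homologyRank j point :=
    have : Nonempty (TopCat.of U) := hne
    homologyRank_eq_reducedRank_add j
  have key' : homologyRank j (TopCat.of U) + homologyRank j (TopCat.of V) =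
      homologyRank j (TopCat.of (U ∩ V : Set E)) + homologyRank j point :=
    key.trans (congrArg _ hr)
  obtain ⟨r, hr⟩ := Cardinal.lt_aleph0.1 (homologyRank_point_lt_aleph0 j)
  rw [hU', hfV, hfW, hr] at key'
  -- The count reads β + r + f r = f (1 + r) + r; the finite summand r + f r cancels.
  refine Cardinal.eq_of_add_eq_add_right (b := (r + f * r : ℕ)) ?_ Cardinal.natCast_lt_aleph0
  push_cast
  rw [← add_assoc, key']
  ring

end TopCat

end

section

open CategoryTheory Simplicial Opposite Limits
open scoped ContinuousMap Topology

/-! ### Relative interiors and radial projections of convex cells -/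

section ConvexCell

variable {E : Type} [NormedAddCommGroup E] [InnerProductSpace ℝ E]

/-- A compact convex set `F`, with a point `b` such that the ball of radius `r` and center `b` in the
affine hull of `F` is contained in `F`. -/
structure IsConvexCell (F : Set E) (b : E) (r : ℝ) : Prop where
  convex : Convex ℝ F
  isCompact : IsCompact F
  pos : 0 < r
  add_mem : ∀ v ∈ vectorSpan ℝ F, ‖v‖ < r → b + v ∈ F

lemma IsConvexCell.mono {F : Set E} {b : E} {r r' : ℝ} (h : IsConvexCell F b r) (hr : 0 < r')
    (hr' : r' ≤ r) : IsConvexCell F b r' :=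
  ⟨h.convex, h.isCompact, hr, fun v hv hv' ↦ h.add_mem v hv (hv'.trans_le hr')⟩

lemma IsConvexCell.center_mem {F : Set E} {b : E} {r : ℝ} (h : IsConvexCell F b r) : b ∈ F := by
  simpa using h.add_mem 0 (zero_mem _) (by simpa using h.pos)

lemma IsConvexCell.sub_center_mem {F : Set E} {b : E} {r : ℝ} (h : IsConvexCell F b r) {x : E}
    (hx : x ∈ F) : x - b ∈ vectorSpan ℝ F :=
  vsub_mem_vectorSpan ℝ hx h.center_mem

variable [FiniteDimensional ℝ E]

lemma exists_isConvexCell {F : Set E} (hc : Convex ℝ F) (hF : IsCompact F) (hne : F.Nonempty) :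
    ∃ b r, IsConvexCell F b r := by
  obtain ⟨_, ⟨b, hb, rfl⟩⟩ := hne.intrinsicInterior hc
  obtain ⟨r, hr, hball⟩ := Metric.mem_nhds_iff.1 (mem_interior_iff_mem_nhds.1 hb)
  refine ⟨b, r, hc, hF, hr, fun v hv hvr ↦ ?_⟩
  rw [← direction_affineSpan] at hv
  have hmem : (b : E) + v ∈ affineSpan ℝ F := by
    rw [add_comm]
    exact AffineSubspace.vadd_mem_of_mem_direction hv b.2
  refine hball (a := ⟨b + v, hmem⟩) ?_
  rw [Metric.mem_ball, Subtype.dist_eq, dist_eq_norm]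
  simpa using hvr

/-- The gauge of a cell, seen from the point `b`. -/
noncomputable def cellGauge (F : Set E) (b x : E) : ℝ :=
  gauge {v | b + (vectorSpan ℝ F).starProjection v ∈ F} (x - b)

lemma cellGauge_nonneg (F : Set E) (b x : E) : 0 ≤ cellGauge F b x := gauge_nonneg _

lemma cellGauge_center (F : Set E) (b : E) : cellGauge F b b = 0 := by
  rw [cellGauge, sub_self, gauge_zero]

lemma mem_preimage_starProjection_iff {F : Set E} {b : E} {v : E} (hv : v ∈ vectorSpan ℝ F) :
    v ∈ {v | b + (vectorSpan ℝ F).starProjection v ∈ F} ↔ b + v ∈ F := by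
  change b + (vectorSpan ℝ F).starProjection v ∈ F ↔ _
  rw [Submodule.starProjection_eq_self_iff.2 hv]

namespace IsConvexCell

variable {F : Set E} {b : E} {r : ℝ} (h : IsConvexCell F b r)

include h

lemma convex_preimage : Convex ℝ {v | b + (vectorSpan ℝ F).starProjection v ∈ F} :=
  (h.convex.translate_preimage_right b).linear_preimage
    (vectorSpan ℝ F).starProjection.toLinearMap

lemma isClosed_preimage : IsClosed {v | b + (vectorSpan ℝ F).starProjection v ∈ F} :=
  h.isCompact.isClosed.preimage (by fun_prop)

/-- Orthogonal projection does not increase norms, so the cylinder over F contains a ball of E. For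
lower-dimensional F the translate F - b does not; this is why the gauge is that of the cylinder. -/
lemma preimage_mem_nhds : {v | b + (vectorSpan ℝ F).starProjection v ∈ F} ∈ 𝓝 (0 : E) := by
  refine Filter.mem_of_superset (Metric.ball_mem_nhds 0 h.pos) fun v hv ↦ ?_
  refine h.add_mem _ (Submodule.starProjection_apply_mem _ _)
    (((vectorSpan ℝ F).norm_starProjection_apply_le v).trans_lt ?_)
  simpa using hv

lemma continuous_cellGauge : Continuous (cellGauge F b) :=
  (continuous_gauge h.convex_preimage h.preimage_mem_nhds).comp (by fun_prop)

lemma cellGauge_le_one {x : E} (hx : x ∈ F) : cellGauge F b x ≤ 1 :=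
  gauge_le_one_of_mem ((mem_preimage_starProjection_iff (h.sub_center_mem hx)).2 (by simpa using hx))

lemma add_mem_of_gauge_le_one {v : E} (hv : v ∈ vectorSpan ℝ F)
    (hg : gauge {v | b + (vectorSpan ℝ F).starProjection v ∈ F} v ≤ 1) : b + v ∈ F := by
  rw [← mem_preimage_starProjection_iff hv, ← h.isClosed_preimage.closure_eq]
  exact (gauge_le_one_iff_mem_closure h.convex_preimage h.preimage_mem_nhds).1 hg

/-- Gauge zero would put the whole ray from b through x into F, against boundedness. -/
lemma cellGauge_pos {x : E} (hx : x ∈ F) (hxb : x ≠ b) : 0 < cellGauge F b x := by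
  refine (gauge_nonneg _).lt_of_ne fun h0 ↦ ?_
  obtain ⟨C, hC⟩ := h.isCompact.isBounded.exists_norm_le
  have hn : 0 < ‖x - b‖ := norm_pos_iff.2 (sub_ne_zero.2 hxb)
  have hb := hC b h.center_mem
  have hC0 : 0 ≤ C := (norm_nonneg _).trans hb
  -- This point of the ray is at distance 2C + 1 from b, while two points of norm at most C are at
  -- distance at most 2C.
  set c := (2 * C + 1) / ‖x - b‖
  have hc : 0 ≤ c := by positivity
  have hmem := hC _ (h.add_mem_of_gauge_le_one (v := c • (x - b))
    (Submodule.smul_mem _ _ (h.sub_center_mem hx)) (by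
      rw [gauge_smul_of_nonneg hc, ← h0, smul_zero]
      exact zero_le_one))
  have h1 : ‖c • (x - b)‖ = 2 * C + 1 := by
    rw [norm_smul, Real.norm_of_nonneg hc, div_mul_cancel₀ _ hn.ne']
  have h2 : ‖c • (x - b)‖ ≤ ‖b + c • (x - b)‖ + ‖b‖ := by
    have := norm_sub_le (b + c • (x - b)) b
    rwa [add_sub_cancel_left] at this
  linarith

lemma radial_mem {x : E} (hx : x ∈ F) : b + (cellGauge F b x)⁻¹ • (x - b) ∈ F := by
  refine h.add_mem_of_gauge_le_one (Submodule.smul_mem _ _ (h.sub_center_mem hx)) ?_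
  rw [gauge_smul_of_nonneg (inv_nonneg.2 (cellGauge_nonneg F b x)), smul_eq_mul]
  -- This also covers x = b, where the inverse of the gauge is zero and the point is b itself.
  exact inv_mul_le_one

lemma cellGauge_radial {x : E} (hx : x ∈ F) (hxb : x ≠ b) :
    cellGauge F b (b + (cellGauge F b x)⁻¹ • (x - b)) = 1 := by
  rw [cellGauge, add_sub_cancel_left, gauge_smul_of_nonneg (inv_nonneg.2 (cellGauge_nonneg F b x)),
    smul_eq_mul]
  exact inv_mul_cancel₀ (h.cellGauge_pos hx hxb).ne'

/-- Points with gauge less than one can be moved slightly in all directions of the cell. -/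
lemma exists_add_smul_mem {x : E} (hx : x ∈ F) (hg : cellGauge F b x < 1) {y : E} (hy : y ∈ F) :
    ∃ ε : ℝ, 0 < ε ∧ x + ε • (x - y) ∈ F := by
  have hcont : Filter.Tendsto (fun ε : ℝ ↦ cellGauge F b (x + ε • (x - y))) (𝓝[>] 0)
      (𝓝 (cellGauge F b (x + (0 : ℝ) • (x - y)))) :=
    ((h.continuous_cellGauge.comp (by fun_prop)).tendsto 0).mono_left nhdsWithin_le_nhds
  rw [zero_smul, add_zero] at hcont
  obtain ⟨ε, hε, hε0⟩ := ((hcont.eventually_lt_const hg).and self_mem_nhdsWithin).exists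
  refine ⟨ε, hε0, ?_⟩
  have hv : x + ε • (x - y) - b ∈ vectorSpan ℝ F := by
    rw [add_sub_right_comm]
    exact Submodule.add_mem _ (h.sub_center_mem hx) (Submodule.smul_mem _ _ (vsub_mem_vectorSpan ℝ hx hy))
  simpa using h.add_mem_of_gauge_le_one hv hε.le

/-- A point of gauge one is in a proper exposed face. -/
lemma exists_isExposed_of_cellGauge_eq_one {y : E} (hy : y ∈ F) (hg : cellGauge F b y = 1) :
    ∃ G : Set E, y ∈ G ∧ IsExposed ℝ F G ∧
      Module.finrank ℝ (vectorSpan ℝ G) < Module.finrank ℝ (vectorSpan ℝ F) := by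
  set K := {v | b + (vectorSpan ℝ F).starProjection v ∈ F}
  have h0 : (0 : E) ∈ interior K := mem_interior_iff_mem_nhds.2 h.preimage_mem_nhds
  have hv : y - b ∉ interior K := by
    rw [← gauge_lt_one_iff_mem_interior h.convex_preimage h.preimage_mem_nhds]
    exact hg.not_lt
  -- A supporting functional at y. It is constant on the face it exposes but positive on y - b, a
  -- direction of F; hence the dimension drops.
  obtain ⟨f, hf⟩ := geometric_hahn_banach_open_point h.convex_preimage.interior isOpen_interior hv
  have hf0 : 0 < f (y - b) := by simpa using hf 0 h0
  have hfK : ∀ v ∈ K, f v ≤ f (y - b) := by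
    intro v hvK
    have hcl : v ∈ closure (interior K) := by
      rw [h.convex_preimage.closure_interior_eq_closure_of_nonempty_interior ⟨0, h0⟩]
      exact subset_closure hvK
    exact closure_minimal (t := {v | f v ≤ f (y - b)}) (fun w hw ↦ (hf w hw).le)
      (isClosed_le f.continuous continuous_const) hcl
  set G := {x | x ∈ F ∧ ∀ z ∈ F, f z ≤ f x}
  have hfy : ∀ x ∈ F, f x ≤ f y := fun x hx ↦ by
    have := hfK (x - b) ((mem_preimage_starProjection_iff (h.sub_center_mem hx)).2 (by simpa using hx))
    rw [map_sub, map_sub] at this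
    linarith
  refine ⟨G, ⟨hy, hfy⟩, fun _ ↦ ⟨f, rfl⟩, Submodule.finrank_lt_finrank_of_lt ?_⟩
  have hG : vectorSpan ℝ G ≤ LinearMap.ker f.toLinearMap := by
    rw [vectorSpan, Submodule.span_le]
    rintro _ ⟨x, hx, z, hz, rfl⟩
    change f (x - z) = 0
    rw [map_sub, sub_eq_zero]
    exact le_antisymm (hz.2 x hx.1) (hx.2 z hz.1)
  refine lt_of_le_of_ne (vectorSpan_mono ℝ fun x hx ↦ hx.1) fun he ↦ ?_
  have := hG (he ▸ h.sub_center_mem hy)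
  exact hf0.ne' this

end IsConvexCell

/-- An exposed face which meets the relative interior of another one contains it. -/
lemma IsConvexCell.subset_of_isExposed {P F G : Set E} {b : E} {r : ℝ} (h : IsConvexCell F b r)
    (hF : F ⊆ P) (hG : IsExposed ℝ P G) {x : E} (hxF : x ∈ F) (hxG : x ∈ G)
    (hg : cellGauge F b x < 1) : F ⊆ G := by
  obtain ⟨l, rfl⟩ := hG ⟨x, hxG⟩
  intro y hy
  refine ⟨hF hy, fun z hz ↦ (hxG.2 z hz).trans ?_⟩
  -- The segment from y to x can be prolonged beyond x within F. As l is maximal at x, it cannot be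
  -- smaller at y.
  obtain ⟨ε, hε, hmem⟩ := h.exists_add_smul_mem hxF hg hy
  have := hxG.2 _ (hF hmem)
  rw [map_add, map_smul, map_sub, smul_eq_mul] at this
  nlinarith

/-- An exposed face contained in another one of at most the same dimension is equal to it. -/
lemma IsExposed.eq_of_subset_of_finrank_le {P F G : Set E} (hF : IsExposed ℝ P F)
    (hne : F.Nonempty) (hG : G ⊆ P) (hFG : F ⊆ G)
    (hdim : Module.finrank ℝ (vectorSpan ℝ G) ≤ Module.finrank ℝ (vectorSpan ℝ F)) : F = G := by
  obtain ⟨l, hl⟩ := hF hne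
  obtain ⟨x, hx⟩ := hne
  refine hFG.antisymm fun z hz ↦ ?_
  have hspan := Submodule.eq_of_le_of_finrank_le (vectorSpan_mono ℝ hFG) hdim
  have hker : vectorSpan ℝ F ≤ LinearMap.ker l.toLinearMap := by
    rw [vectorSpan, Submodule.span_le]
    rintro _ ⟨y, hy, w, hw, rfl⟩
    change l (y - w) = 0
    rw [hl] at hy hw
    rw [map_sub, sub_eq_zero]
    exact le_antisymm (hw.2 y hy.1) (hy.2 w hw.1)
  have hzx : l (z - x) = 0 := hker (hspan ▸ vsub_mem_vectorSpan ℝ hz (hFG hx))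
  rw [map_sub, sub_eq_zero] at hzx
  rw [hl] at hx ⊢
  exact ⟨hG hz, fun y hy ↦ hzx ▸ hx.2 y hy⟩

end ConvexCell

end

section

open CategoryTheory Simplicial Opposite Limits
open scoped ContinuousMap Topology

/-! ### Attaching convex cells -/

section CellAttachment

variable {E : Type} [NormedAddCommGroup E] [InnerProductSpace ℝ E]
  [FiniteDimensional ℝ E] {ι : Type}

/-- The space `X` is the union of `A` and of convex cells, which meet `A` in their relative
boundaries and whose relative interiors are disjoint. -/
structure IsCellAttachment (A X : Set E) (F : ι → Set E) (b : ι → E) (r : ι → ℝ) : Prop where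
  cell : ∀ i, IsConvexCell (F i) (b i) (r i)
  isClosed : IsClosed A
  eq_union : X = A ∪ ⋃ i, F i
  gauge_eq_one : ∀ i, ∀ x ∈ F i, x ∈ A → cellGauge (F i) (b i) x = 1
  gauge_eq_one_of_ne : ∀ i j, i ≠ j → ∀ x ∈ F i, x ∈ F j → cellGauge (F i) (b i) x = 1
  mem_of_gauge : ∀ i, ∀ x ∈ F i, cellGauge (F i) (b i) x = 1 → x ∈ A

open Classical in
/-- The displacement of the radial projection of a cell, extended by zero. -/
noncomputable def cellDisplacement (F : Set E) (b x : E) : E :=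
  if x ∈ F then ((cellGauge F b x)⁻¹ - 1) • (x - b) else 0

lemma cellDisplacement_of_mem {F : Set E} {b x : E} (hx : x ∈ F) :
    cellDisplacement F b x = ((cellGauge F b x)⁻¹ - 1) • (x - b) := if_pos hx

lemma cellDisplacement_eq_zero {F : Set E} {b x : E} (h : x ∈ F → cellGauge F b x = 1) :
    cellDisplacement F b x = 0 := by
  by_cases hx : x ∈ F
  · rw [cellDisplacement_of_mem hx, h hx, inv_one, sub_self, zero_smul]
  · exact if_neg hx

lemma ne_of_mem_diff_range {α ι : Type*} {X : Set α} {b : ι → α} {x : α} (hx : x ∈ X \ Set.range b)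
    (i : ι) : x ≠ b i :=
  fun hi ↦ hx.2 ⟨i, hi.symm⟩

namespace IsCellAttachment

variable {A X : Set E} {F : ι → Set E} {b : ι → E} {r : ι → ℝ} (h : IsCellAttachment A X F b r)

include h

lemma center_notMem (i : ι) : b i ∉ A := fun hA ↦ by
  have := h.gauge_eq_one i (b i) (h.cell i).center_mem hA
  rw [cellGauge_center] at this
  exact zero_ne_one this

lemma center_notMem_of_ne {i j : ι} (hij : i ≠ j) : b i ∉ F j := fun hA ↦ by
  have := h.gauge_eq_one_of_ne i j hij (b i) (h.cell i).center_mem hA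
  rw [cellGauge_center] at this
  exact zero_ne_one this

lemma subset_diff_range : A ⊆ X \ Set.range b := fun x hx ↦
  ⟨by rw [h.eq_union]; exact Or.inl hx, by rintro ⟨i, rfl⟩; exact h.center_notMem i hx⟩

lemma mem_or_exists_mem {x : E} (hx : x ∈ X) : x ∈ A ∨ ∃ i, x ∈ F i := by
  rw [h.eq_union] at hx
  exact hx.imp_right Set.mem_iUnion.1

lemma center_notMem_others (i : ι) : b i ∉ A ∪ ⋃ j ∈ {j | j ≠ i}, F j := by
  rintro (hA | hF)
  · exact h.center_notMem i hA
  · obtain ⟨j, hj, hb⟩ := Set.mem_iUnion₂.1 hF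
    exact h.center_notMem_of_ne (Ne.symm hj) hb

lemma subset_union_others (i : ι) : X ⊆ F i ∪ (A ∪ ⋃ j ∈ {j | j ≠ i}, F j) := by
  intro x hx
  rcases h.mem_or_exists_mem hx with hA | ⟨j, hj⟩
  · exact Or.inr (Or.inl hA)
  · by_cases hij : j = i
    · exact Or.inl (hij ▸ hj)
    · exact Or.inr (Or.inr (Set.mem_iUnion₂.2 ⟨j, hij, hj⟩))

variable [Fintype ι]

lemma isClosed_others (i : ι) : IsClosed (A ∪ ⋃ j ∈ {j | j ≠ i}, F j) :=
  h.isClosed.union ((Set.toFinite _).isClosed_biUnion fun j _ ↦ (h.cell j).isCompact.isClosed)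

lemma sum_cellDisplacement_of_mem {i : ι} {x : E} (hx : x ∈ F i) :
    ∑ j, cellDisplacement (F j) (b j) x =
      ((cellGauge (F i) (b i) x)⁻¹ - 1) • (x - b i) := by
  rw [← cellDisplacement_of_mem hx]
  exact Finset.sum_eq_single i (fun j _ hj ↦ cellDisplacement_eq_zero fun hxj ↦
    h.gauge_eq_one_of_ne j i hj x hxj hx) fun hi ↦ absurd (Finset.mem_univ i) hi

lemma sum_cellDisplacement_of_mem_base {x : E} (hx : x ∈ A) :
    ∑ j, cellDisplacement (F j) (b j) x = 0 :=
  Finset.sum_eq_zero fun j _ ↦ cellDisplacement_eq_zero fun hxj ↦ h.gauge_eq_one j x hxj hx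

/-- Pasting along two closed sets: on the cell the gauge is nonzero away from the center, and on A
and the other cells the displacement vanishes because overlaps have gauge one. -/
lemma continuous_cellDisplacement (i : ι) :
    Continuous fun x : (X \ Set.range b : Set E) ↦ cellDisplacement (F i) (b i) (x : E) := by
  have hu : (Set.univ : Set (X \ Set.range b : Set E)) = Subtype.val ⁻¹' F i ∪
      Subtype.val ⁻¹' (A ∪ ⋃ j ∈ {j | j ≠ i}, F j) :=
    (Set.eq_univ_of_forall fun x : (X \ Set.range b : Set E) ↦
      h.subset_union_others i x.2.1).symm
  rw [← continuousOn_univ, hu]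
  refine ContinuousOn.union_of_isClosed ?_ ?_
    ((h.cell i).isCompact.isClosed.preimage continuous_subtype_val)
    ((h.isClosed_others i).preimage continuous_subtype_val)
  · have hg := (h.cell i).continuous_cellGauge
    refine ContinuousOn.congr (f := fun x : (X \ Set.range b : Set E) ↦
      ((cellGauge (F i) (b i) (x : E))⁻¹ - 1) • ((x : E) - b i)) ?_
      fun x hx ↦ cellDisplacement_of_mem hx
    refine ContinuousOn.smul (ContinuousOn.sub (ContinuousOn.inv₀
      (hg.comp continuous_subtype_val).continuousOn fun x hx ↦ ?_) continuousOn_const)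
      (by fun_prop)
    exact ((h.cell i).cellGauge_pos hx (ne_of_mem_diff_range x.2 i)).ne'
  · refine (continuousOn_const (c := 0)).congr fun x hx ↦ cellDisplacement_eq_zero fun hxi ↦ ?_
    rcases hx with hA | hF
    · exact h.gauge_eq_one i x hxi hA
    · obtain ⟨j, hj, hb⟩ := Set.mem_iUnion₂.1 hF
      exact h.gauge_eq_one_of_ne i j (Ne.symm hj) x hxi hb

lemma add_sum_cellDisplacement_mem {x : E} (hx : x ∈ X \ Set.range b) :
    x + ∑ j, cellDisplacement (F j) (b j) x ∈ A := by
  rcases h.mem_or_exists_mem hx.1 with hA | ⟨i, hi⟩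
  · rwa [h.sum_cellDisplacement_of_mem_base hA, add_zero]
  · have : x + ((cellGauge (F i) (b i) x)⁻¹ - 1) • (x - b i) =
        b i + (cellGauge (F i) (b i) x)⁻¹ • (x - b i) := by
      rw [sub_smul, one_smul]
      abel
    rw [h.sum_cellDisplacement_of_mem hi, this]
    exact h.mem_of_gauge i _ ((h.cell i).radial_mem hi)
      ((h.cell i).cellGauge_radial hi (ne_of_mem_diff_range hx i))

lemma add_smul_sum_cellDisplacement_mem {x : E} (hx : x ∈ X \ Set.range b) {τ : ℝ} (h0 : 0 ≤ τ)
    (h1 : τ ≤ 1) : x + τ • ∑ j, cellDisplacement (F j) (b j) x ∈ X \ Set.range b := by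
  rcases h.mem_or_exists_mem hx.1 with hA | ⟨i, hi⟩
  · rwa [h.sum_cellDisplacement_of_mem_base hA, smul_zero, add_zero]
  · have hmem : x + τ • ∑ j, cellDisplacement (F j) (b j) x ∈ F i := by
      have hr := (h.cell i).radial_mem hi
      have := (h.cell i).convex hi hr (sub_nonneg.2 h1) h0 (sub_add_cancel 1 τ)
      convert this using 1
      rw [h.sum_cellDisplacement_of_mem hi]
      module
    refine ⟨by rw [h.eq_union]; exact Or.inr (Set.mem_iUnion.2 ⟨i, hmem⟩), ?_⟩
    rintro ⟨j, hj⟩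
    by_cases hij : j = i
    · subst hij
      rw [h.sum_cellDisplacement_of_mem hi] at hj
      have hpos := (h.cell j).cellGauge_pos hi (ne_of_mem_diff_range hx j)
      have hle := (h.cell j).cellGauge_le_one hi
      have h2 : (1 + τ * ((cellGauge (F j) (b j) x)⁻¹ - 1)) • (x - b j) = 0 := by
        rw [add_smul, one_smul, mul_smul, sub_add_eq_add_sub, ← hj, sub_self]
      -- The motion scales x - b j by a factor at least one, so it never reaches the center.
      have h3 : 1 ≤ (cellGauge (F j) (b j) x)⁻¹ := (one_le_inv₀ hpos).2 hle
      rcases smul_eq_zero.1 h2 with h4 | h4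
      · nlinarith [mul_nonneg h0 (sub_nonneg.2 h3)]
      · exact ne_of_mem_diff_range hx j (sub_eq_zero.1 h4)
    · exact h.center_notMem_of_ne hij (hj ▸ hmem)

/-- The complement of the centers of the cells is homotopy equivalent to `A`. -/
noncomputable def homotopyEquiv : (X \ Set.range b : Set E) ≃ₕ A where
  toFun := ⟨fun x ↦ ⟨_, h.add_sum_cellDisplacement_mem x.2⟩,
    (continuous_subtype_val.add (continuous_finsetSum _ fun i _ ↦
      h.continuous_cellDisplacement i)).subtype_mk _⟩
  invFun := ⟨Set.inclusion h.subset_diff_range, continuous_inclusion _⟩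
  left_inv := ⟨{
    -- Time is reversed: the homotopy starts at the retraction and ends at the identity.
    toFun := fun p ↦ ⟨_, h.add_smul_sum_cellDisplacement_mem p.2.2 (τ := 1 - p.1.1)
      (sub_nonneg.2 p.1.2.2) (sub_le_self _ p.1.2.1)⟩
    continuous_toFun := by
      have : Continuous fun x : (X \ Set.range b : Set E) ↦
          ∑ j, cellDisplacement (F j) (b j) (x : E) :=
        continuous_finsetSum _ fun i _ ↦ h.continuous_cellDisplacement i
      refine Continuous.subtype_mk ((continuous_subtype_val.comp continuous_snd).add
        (Continuous.smul (by fun_prop) (this.comp continuous_snd))) _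
    map_zero_left := fun x ↦ Subtype.ext (by simp)
    map_one_left := fun x ↦ Subtype.ext (by simp) }⟩
  right_inv := by
    have : ContinuousMap.comp (⟨fun x ↦ ⟨_, h.add_sum_cellDisplacement_mem x.2⟩,
        (continuous_subtype_val.add (continuous_finsetSum _ fun i _ ↦
        h.continuous_cellDisplacement i)).subtype_mk _⟩ : C((X \ Set.range b : Set E), A))
        ⟨Set.inclusion h.subset_diff_range, continuous_inclusion _⟩ = ContinuousMap.id A :=
      ContinuousMap.ext fun x ↦ Subtype.ext (by
        change (x : E) + ∑ j, cellDisplacement (F j) (b j) (x : E) = x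
        rw [h.sum_cellDisplacement_of_mem_base x.2, add_zero])
    rw [this]

end IsCellAttachment

end CellAttachment

end

/-! ### Punctured discs in cells and the rank of the base -/

section

open CategoryTheory Simplicial Opposite Limits
open scoped ContinuousMap Topology

section PuncturedCell

variable {E : Type} [NormedAddCommGroup E] [InnerProductSpace ℝ E] {F : Set E} {b : E} {r : ℝ}

namespace IsConvexCell

variable (h : IsConvexCell F b r)

include h

lemma add_smul_mem_punctured {v : E} (hv : v ∈ vectorSpan ℝ F) (hv0 : v ≠ 0) {a : ℝ} (ha : 0 < a)
    (har : a * ‖v‖ < r) : b + a • v ∈ (F ∩ Metric.ball b r) \ {b} := by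
  have hn : ‖a • v‖ < r := by rwa [norm_smul, Real.norm_of_nonneg ha.le]
  refine ⟨⟨h.add_mem _ (Submodule.smul_mem _ _ hv) hn, ?_⟩, ?_⟩
  · rwa [Metric.mem_ball, dist_eq_norm, add_sub_cancel_left]
  · rw [Set.mem_singleton_iff, add_eq_left, smul_eq_zero, not_or]
    exact ⟨ha.ne', hv0⟩

lemma div_one_add_norm_pos (v : E) : 0 < r / (1 + ‖v‖) :=
  div_pos h.pos (by positivity)

lemma div_one_add_norm_mul_lt (v : E) : r / (1 + ‖v‖) * ‖v‖ < r := by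
  rw [div_mul_eq_mul_div, div_lt_iff₀ (by positivity)]
  nlinarith [h.pos, norm_nonneg v]

/-- A small punctured disc in a cell is homotopy equivalent to a punctured vector space. -/
noncomputable def puncturedHomotopyEquiv :
    ((F ∩ Metric.ball b r) \ {b} : Set E) ≃ₕ ({0}ᶜ : Set (vectorSpan ℝ F)) where
  toFun := ⟨fun x ↦ ⟨⟨x - b, h.sub_center_mem x.2.1.1⟩,
    fun h0 ↦ sub_ne_zero.2 x.2.2 (congrArg Subtype.val h0)⟩, by fun_prop⟩
  -- The factor r / (1 + ‖v‖) shrinks the whole space into the open disc. Both homotopies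
  -- interpolate linearly between this factor and 1, so the scaling stays positive.
  invFun := ⟨fun v ↦ ⟨b + (r / (1 + ‖v.1.1‖)) • v.1.1, h.add_smul_mem_punctured v.1.2
      (fun h0 ↦ v.2 (Subtype.ext h0)) (h.div_one_add_norm_pos _) (h.div_one_add_norm_mul_lt _)⟩, by
    have h0 (v : ({0}ᶜ : Set (vectorSpan ℝ F))) : (1 + ‖v.1.1‖) ≠ 0 := by positivity
    fun_prop (disch := assumption)⟩
  left_inv := ⟨{
    toFun := fun p ↦ ⟨b + ((1 - p.1.1) * (r / (1 + ‖p.2.1 - b‖)) + p.1.1) • (p.2.1 - b), by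
      have h1 := h.div_one_add_norm_pos (p.2.1 - b)
      have h2 := h.div_one_add_norm_mul_lt (p.2.1 - b)
      have h3 := mem_ball_iff_norm.1 p.2.2.1.2
      have h4 := p.1.2.1
      have h5 := p.1.2.2
      refine h.add_smul_mem_punctured (h.sub_center_mem p.2.2.1.1) (sub_ne_zero.2 p.2.2.2) ?_ ?_
      · rcases h4.eq_or_lt with h6 | h6
        · rw [← h6]
          linarith
        · exact add_pos_of_nonneg_of_pos (mul_nonneg (sub_nonneg.2 h5) h1.le) h6
      · rcases h4.eq_or_lt with h6 | h6
        · rw [← h6]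
          linarith
        · nlinarith [mul_le_mul_of_nonneg_left h2.le (sub_nonneg.2 h5), mul_lt_mul_of_pos_left h3 h6]⟩
    continuous_toFun := by
      have h0 (p : unitInterval × ((F ∩ Metric.ball b r) \ {b} : Set E)) :
        (1 + ‖p.2.1 - b‖) ≠ 0 := by positivity
      fun_prop (disch := assumption)
    map_zero_left := fun x ↦ Subtype.ext (by simp)
    map_one_left := fun x ↦ Subtype.ext (by simp) }⟩
  right_inv := ⟨{
    toFun := fun p ↦ ⟨((1 - p.1.1) * (r / (1 + ‖p.2.1.1‖)) + p.1.1) • p.2.1, by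
      have h1 := h.div_one_add_norm_pos p.2.1.1
      have h4 := p.1.2.1
      have h5 := p.1.2.2
      rw [Set.mem_compl_iff, Set.mem_singleton_iff, smul_eq_zero, not_or]
      refine ⟨ne_of_gt ?_, p.2.2⟩
      rcases h4.eq_or_lt with h6 | h6
      · rw [← h6]
        linarith
      · exact add_pos_of_nonneg_of_pos (mul_nonneg (sub_nonneg.2 h5) h1.le) h6⟩
    continuous_toFun := by
      have h0 (p : unitInterval × ({0}ᶜ : Set (vectorSpan ℝ F))) :
        (1 + ‖p.2.1.1‖) ≠ 0 := by positivity
      fun_prop (disch := assumption)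
    map_zero_left := fun x ↦ Subtype.ext (Subtype.ext (by simp))
    map_one_left := fun x ↦ Subtype.ext (Subtype.ext (by simp)) }⟩

end IsConvexCell

end PuncturedCell

lemma disjoint_ball_of_disjoint_others {E ι : Type*} [PseudoMetricSpace E] {A : Set E}
    {F : ι → Set E} {b : ι → E} {r : ι → ℝ}
    (hd : ∀ i, Disjoint (Metric.ball (b i) (r i)) (A ∪ ⋃ j ∈ {j | j ≠ i}, F j)) {i j : ι}
    (hij : i ≠ j) : Disjoint (Metric.ball (b i) (r i)) (F j) :=
  (hd i).mono_right fun _ hx ↦ Or.inr (Set.mem_iUnion₂.2 ⟨j, (Ne.symm hij : j ≠ i), hx⟩)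

section CellAttachment

variable {E : Type} [NormedAddCommGroup E] [InnerProductSpace ℝ E] [FiniteDimensional ℝ E]
  {ι : Type} {A X : Set E} {F : ι → Set E} {b : ι → E} {r : ι → ℝ}

namespace IsCellAttachment

/-- The radii of a cell attachment can be chosen such that the balls only meet their cells. -/
lemma exists_radius [Fintype ι] (h : IsCellAttachment A X F b r) : ∃ r', IsCellAttachment A X F b r' ∧
    ∀ i, Disjoint (Metric.ball (b i) (r' i)) (A ∪ ⋃ j ∈ {j | j ≠ i}, F j) := by
  have hε (i) : ∃ ε > 0, Metric.ball (b i) ε ⊆ (A ∪ ⋃ j ∈ {j | j ≠ i}, F j)ᶜ :=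
    Metric.isOpen_iff.1 (h.isClosed_others i).isOpen_compl _ (h.center_notMem_others i)
  choose ε hε0 hε using hε
  refine ⟨fun i ↦ min (r i) (ε i), { h with
    cell := fun i ↦ (h.cell i).mono (lt_min (h.cell i).pos (hε0 i)) (min_le_left _ _) }, fun i ↦ ?_⟩
  exact Set.disjoint_left.2 fun x hx ↦ hε i (Metric.ball_subset_ball (min_le_right _ _) hx)

variable (h : IsCellAttachment A X F b r)
  (hd : ∀ i, Disjoint (Metric.ball (b i) (r i)) (A ∪ ⋃ j ∈ {j | j ≠ i}, F j))

include h hd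

/-- Each ball meets X only in its own cell, so the union of the discs is relatively open in X. -/
lemma mem_iUnion_inter_ball_iff {x : E} :
    x ∈ ⋃ i, F i ∩ Metric.ball (b i) (r i) ↔ x ∈ X ∧ x ∈ ⋃ i, Metric.ball (b i) (r i) := by
  simp only [Set.mem_iUnion, Set.mem_inter_iff]
  constructor
  · rintro ⟨i, hx, hi⟩
    exact ⟨by rw [h.eq_union]; exact Or.inr (Set.mem_iUnion.2 ⟨i, hx⟩), i, hi⟩
  · rintro ⟨hx, i, hi⟩
    exact ⟨i, (h.subset_union_others i hx).resolve_right fun h' ↦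
      Set.disjoint_left.1 (hd i) hi h', hi⟩

variable [Fintype ι]

lemma diff_range_inter_iUnion : (X \ Set.range b) ∩ (⋃ i, F i ∩ Metric.ball (b i) (r i)) =
    ⋃ i ∈ Finset.univ, (F i ∩ Metric.ball (b i) (r i)) \ {b i} := by
  ext x
  simp only [Finset.mem_univ, Set.iUnion_true, Set.mem_iUnion]
  constructor
  · rintro ⟨hx, hx'⟩
    obtain ⟨i, hi⟩ := Set.mem_iUnion.1 hx'
    exact ⟨i, hi, ne_of_mem_diff_range hx i⟩
  · rintro ⟨i, hi, hne⟩
    have hV : x ∈ ⋃ i, F i ∩ Metric.ball (b i) (r i) := Set.mem_iUnion.2 ⟨i, hi⟩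
    refine ⟨⟨((h.mem_iUnion_inter_ball_iff hd).1 hV).1, ?_⟩, hV⟩
    rintro ⟨j, rfl⟩
    refine Set.disjoint_left.1 (disjoint_ball_of_disjoint_others hd (i := i) (j := j) ?_) hi.2 (h.cell j).center_mem
    rintro rfl
    exact hne rfl

open TopCat in
/-- The reduced homology of the base of an attachment of `f` cells of dimension `j + 1`, in case
the result has trivial reduced homology in degree `j + 1` and finite reduced homology in degree
`j`. -/
lemma reducedRank_eq_card (j : ℕ) (hj : ∀ i, Module.finrank ℝ (vectorSpan ℝ (F i)) = j + 1)
    (h₁ : Subsingleton (LinearMap.ker (augmentation (j + 1) (TopCat.of X))))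
    (h₀ : Finite (LinearMap.ker (augmentation j (TopCat.of X)))) :
    reducedRank j (TopCat.of A) = Fintype.card ι := by
  have hpunct (i : ι) : Nonempty ({0}ᶜ : Set (vectorSpan ℝ (F i))) := by
    have : Nontrivial (vectorSpan ℝ (F i)) := Module.nontrivial_of_finrank_pos (R := ℝ) (by
      rw [hj]; exact j.succ_pos)
    obtain ⟨v, hv⟩ := exists_ne (0 : vectorSpan ℝ (F i))
    exact ⟨⟨v, hv⟩⟩
  rcases isEmpty_or_nonempty ι with hι | ⟨⟨i₀⟩⟩
  -- Without cells there is no punctured disc to make U nonempty; here the rank is zero by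
  -- finiteness.
  · have hX : X = A := by simpa using h.eq_union
    subst hX
    rw [Fintype.card_eq_zero, Nat.cast_zero]
    exact @rank_int_of_finite _ _ (Submodule.module _) h₀
  have hne : Nonempty (X \ Set.range b : Set E) := by
    obtain ⟨v⟩ := hpunct i₀
    have := ((h.cell i₀).puncturedHomotopyEquiv.invFun v).2
    exact ⟨_, ((h.diff_range_inter_iUnion hd).symm.subset
      (Set.mem_iUnion₂.2 ⟨i₀, Finset.mem_univ _, this⟩)).1⟩
  have hball (i : ι) : ∀ j, i ≠ j → Disjoint (Metric.ball (b i) (r i)) (F j) :=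
    fun j hij ↦ disjoint_ball_of_disjoint_others hd hij
  rw [← reducedRank_congr j (X := TopCat.of (X \ Set.range b : Set E)) (Y := TopCat.of A)
    h.homotopyEquiv]
  refine reducedRank_eq_of_isOpen_cover (X := X) (V := ⋃ i, F i ∩ Metric.ball (b i) (r i))
    Set.sdiff_subset (fun x hx ↦ ((h.mem_iUnion_inter_ball_iff hd).1 hx).1) ?_ ?_ ?_ j _ h₁ h₀ ?_ ?_
  · have : (Subtype.val ⁻¹' (X \ Set.range b) : Set X) = Subtype.val ⁻¹' (Set.range b)ᶜ := by
      ext x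
      simp
    rw [this]
    exact (Set.finite_range b).isClosed.isOpen_compl.preimage continuous_subtype_val
  · have : (Subtype.val ⁻¹' (⋃ i, F i ∩ Metric.ball (b i) (r i)) : Set X) =
        Subtype.val ⁻¹' (⋃ i, Metric.ball (b i) (r i)) := by
      ext x
      exact (h.mem_iUnion_inter_ball_iff hd).trans (and_iff_right x.2)
    rw [this]
    exact (isOpen_iUnion fun i ↦ Metric.isOpen_ball).preimage continuous_subtype_val
  · intro x hx
    by_cases hb : x ∈ Set.range b
    · obtain ⟨i, rfl⟩ := hb
      exact Or.inr (Set.mem_iUnion.2 ⟨i, (h.cell i).center_mem,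
        Metric.mem_ball_self (h.cell i).pos⟩)
    · exact Or.inl ⟨hx, hb⟩
  · have hU := homologyRank_biUnion Finset.univ (fun i ↦ F i ∩ Metric.ball (b i) (r i))
      (fun i ↦ Metric.ball (b i) (r i)) (fun _ ↦ Metric.isOpen_ball)
      (fun _ ↦ Set.inter_subset_right)
      (fun i _ j _ hij ↦ (hball i j hij).mono_right Set.inter_subset_left) j
    have hc (i : ι) : homologyRank j (TopCat.of (F i ∩ Metric.ball (b i) (r i) : Set E)) =
        homologyRank j point :=
      have : ContractibleSpace (TopCat.of (F i ∩ Metric.ball (b i) (r i) : Set E)) :=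
        ((h.cell i).convex.inter (convex_ball _ _)).contractibleSpace
          ⟨b i, (h.cell i).center_mem, Metric.mem_ball_self (h.cell i).pos⟩
      homologyRank_of_contractible j
    have hV : (⋃ i, F i ∩ Metric.ball (b i) (r i)) =
        ⋃ i ∈ Finset.univ, F i ∩ Metric.ball (b i) (r i) := by simp
    rw [hV, hU, Finset.sum_congr rfl fun i _ ↦ hc i, Finset.sum_const, Finset.card_univ,
      nsmul_eq_mul]
  · have hU := homologyRank_biUnion Finset.univ (fun i ↦ (F i ∩ Metric.ball (b i) (r i)) \ {b i})
      (fun i ↦ Metric.ball (b i) (r i)) (fun _ ↦ Metric.isOpen_ball)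
      (fun _ ↦ Set.sdiff_subset.trans Set.inter_subset_right)
      (fun i _ j _ hij ↦ (hball i j hij).mono_right (Set.sdiff_subset.trans Set.inter_subset_left)) j
    have hc (i : ι) : homologyRank j
        (TopCat.of ((F i ∩ Metric.ball (b i) (r i)) \ {b i} : Set E)) = 1 + homologyRank j point := by
      have : Nonempty (TopCat.of ({0}ᶜ : Set (vectorSpan ℝ (F i)))) := hpunct i
      rw [homologyRank_congr j (Y := TopCat.of ({0}ᶜ : Set (vectorSpan ℝ (F i))))
        (h.cell i).puncturedHomotopyEquiv, homologyRank_eq_reducedRank_add,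
        reducedRank_compl_zero j _ (hj i)]
    rw [h.diff_range_inter_iUnion hd, hU, Finset.sum_congr rfl fun i _ ↦ hc i, Finset.sum_const,
      Finset.card_univ, nsmul_eq_mul]

end IsCellAttachment

end CellAttachment

end

section

open CategoryTheory Simplicial Opposite Limits
open scoped ContinuousMap Topology

/-! ### Faces of polytopes -/

section Faces

variable {n : ℕ} {P F G : Set (EuclideanSpace ℝ (Fin n))}

lemma IsConvexPolytope.convex (hP : IsConvexPolytope P) : Convex ℝ P := by
  obtain ⟨S, rfl⟩ := hP
  exact convex_convexHull ℝ _

lemma IsConvexPolytope.isCompact (hP : IsConvexPolytope P) : IsCompact P := by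
  obtain ⟨S, rfl⟩ := hP
  exact S.finite_toSet.isCompact_convexHull ℝ

lemma IsFace.subset (h : IsFace P F) : F ⊆ P := h.2.subset

lemma IsFace.isCompact (hP : IsConvexPolytope P) (h : IsFace P F) : IsCompact F :=
  h.2.isCompact hP.isCompact

lemma IsFace.convex (hP : IsConvexPolytope P) (h : IsFace P F) : Convex ℝ F :=
  h.2.convex hP.convex

/-- A polytope has finitely many faces. -/
lemma finite_faceComplex (hP : IsConvexPolytope P) : (faceComplex P).Finite := by
  have hP' := hP
  obtain ⟨S, rfl⟩ := hP
  -- A face is recovered from S ∩ F: by Krein-Milman it is the closed convex hull of its extreme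
  -- points, which are extreme in P and hence lie in S.
  refine (S.finite_toSet.finite_subsets.image fun s ↦ closure (convexHull ℝ s)).subset fun F hF ↦
    ⟨S ∩ F, Set.inter_subset_left, ?_⟩
  have hcpt := IsFace.isCompact hP' hF
  have hconv := IsFace.convex hP' hF
  refine Set.Subset.antisymm (closure_minimal (convexHull_min Set.inter_subset_right hconv)
    hcpt.isClosed) ?_
  have hext : F.extremePoints ℝ ⊆ S ∩ F := fun x hx ↦
    ⟨extremePoints_convexHull_subset (hF.2.isExtreme.extremePoints_subset_extremePoints hx), hx.1⟩
  exact (closure_convexHull_extremePoints hcpt hconv).symm.subset.trans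
    (closure_mono (convexHull_mono hext))

lemma faceDim_mono (h : F ⊆ G) : faceDim F ≤ faceDim G :=
  Submodule.finrank_mono (vectorSpan_mono ℝ h)

end Faces

/-! ### Spanning trees as cell attachments -/

section SpanningTree

variable {n k : ℕ} {P : Set (EuclideanSpace ℝ (Fin n))} {T : Set (Set (EuclideanSpace ℝ (Fin n)))}

lemma skeleton_skeleton {Sig : Set (Set (EuclideanSpace ℝ (Fin n)))} {i j : ℕ} (hij : i ≤ j) :
    skeleton (skeleton Sig j) i = skeleton Sig i := by
  ext F
  exact ⟨fun h ↦ ⟨h.1.1, h.2⟩, fun h ↦ ⟨⟨h.1, h.2.trans hij⟩, h.2⟩⟩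

/-- A complex with the same skeleton is obtained by attaching cells to it. -/
lemma exists_isCellAttachment (hk : 1 ≤ k) (hP : IsConvexPolytope P)
    (hT : IsSubcomplex T (skeleton (faceComplex P) k))
    (hs : skeleton T (k - 1) = skeleton (faceComplex P) (k - 1)) :
    ∃ b r, IsCellAttachment (⋃₀ skeleton (faceComplex P) (k - 1)) (⋃₀ T)
      (fun F : {F | F ∈ T ∧ faceDim F = k} ↦ F.1) b r := by
  have hface : ∀ F ∈ T, IsFace P F := fun F hF ↦ (hT.1 hF).1
  have hex (F : {F | F ∈ T ∧ faceDim F = k}) : ∃ b r, IsConvexCell F.1 b r :=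
    exists_isConvexCell ((hface F F.2.1).convex hP) ((hface F F.2.1).isCompact hP)
      (hface F F.2.1).1
  choose b r hbr using hex
  refine ⟨b, r, hbr, ?_, ?_, ?_, ?_, ?_⟩
  · rw [Set.sUnion_eq_biUnion]
    exact Set.Finite.isClosed_biUnion ((finite_faceComplex hP).subset fun F hF ↦ hF.1)
      fun F hF ↦ (IsFace.isCompact hP hF.1).isClosed
  · ext x
    constructor
    · rintro ⟨F, hF, hx⟩
      by_cases hd : faceDim F = k
      · exact Or.inr (Set.mem_iUnion.2 ⟨⟨F, hF, hd⟩, hx⟩)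
      · have hle := (hT.1 hF).2
        exact Or.inl ⟨F, ⟨(hT.1 hF).1, by omega⟩, hx⟩
    · rintro (⟨F, hF, hx⟩ | hx)
      · rw [← hs] at hF
        exact ⟨F, hF.1, hx⟩
      · obtain ⟨F, hF⟩ := Set.mem_iUnion.1 hx
        exact ⟨F.1, F.2.1, hF⟩
  · rintro F x hxF ⟨G, hG, hxG⟩
    -- Gauge less than one would force F ⊆ G, although G has smaller dimension.
    refine ((hbr F).cellGauge_le_one hxF).antisymm (not_lt.1 fun hlt ↦ ?_)
    have := faceDim_mono ((hbr F).subset_of_isExposed (hface F F.2.1).subset hG.1.2 hxF hxG hlt)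
    have h₁ := hG.2
    have h₂ := F.2.2
    omega
  · rintro F G hFG x hxF hxG
    refine ((hbr F).cellGauge_le_one hxF).antisymm (not_lt.1 fun hlt ↦ hFG (Subtype.ext ?_))
    have hFP := hface F F.2.1
    have hGP := hface G G.2.1
    refine hFP.2.eq_of_subset_of_finrank_le hFP.1 hGP.subset
      ((hbr F).subset_of_isExposed hFP.subset hGP.2 hxF hxG hlt) ?_
    exact (G.2.2.trans F.2.2.symm).le
  · intro F x hxF hx
    obtain ⟨G, hxG, hG, hlt⟩ := (hbr F).exists_isExposed_of_cellGauge_eq_one hxF hx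
    -- A priori G is only a face of F; that T is closed under faces and consists of faces of P makes
    -- G a face of P.
    have hGT := hT.2 F F.2.1 G ⟨⟨x, hxG⟩, hG⟩
    have h₁ : faceDim G < faceDim F.1 := hlt
    have h₂ := F.2.2
    exact ⟨G, ⟨(hT.1 hGT).1, by omega⟩, hxG⟩

lemma betti_eq_toNat_reducedRank (i : ℕ) (X : TopCat.{0}) :
    betti i X = Cardinal.toNat (TopCat.reducedRank i X) := by
  rw [betti, Module.finrank, TopCat.reducedRank, LinearMap.kerRank]
  congr 2
  exact Subsingleton.elim _ _

end SpanningTree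

end

theorem mainTheorem5 (n k : ℕ) (hk : 1 ≤ k) (P : Set (EuclideanSpace ℝ (Fin n)))
    (hP : IsConvexPolytope P) (T : Set (Set (EuclideanSpace ℝ (Fin n))))
    (hT : IsSpanningTree k (skeleton (faceComplex P) k) T) :
    faceCount T k = betti (k - 1) (realization (skeleton (faceComplex P) (k - 1))) := by
  obtain ⟨j, rfl⟩ : ∃ j, k = j + 1 := ⟨k - 1, by omega⟩
  obtain ⟨b, r₀, h₀⟩ := exists_isCellAttachment hk hP hT.subcomplex
    (hT.spanning.trans (skeleton_skeleton (Nat.sub_le _ _)))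
  have : Fintype {F | F ∈ T ∧ faceDim F = j + 1} :=
    ((finite_faceComplex hP).subset fun F hF ↦ (hT.subcomplex.1 hF.1).1).fintype
  obtain ⟨r, h, hd⟩ := h₀.exists_radius
  -- `reducedHomology` is by definition the kernel of the augmentation, so the tree conditions are
  -- exactly the two homological hypotheses.
  have key := h.reducedRank_eq_card hd j (fun F ↦ F.2.2) hT.acyclic hT.connected
  rw [betti_eq_toNat_reducedRank]
  refine Eq.trans ?_ (congrArg Cardinal.toNat key).symm
  rw [Cardinal.toNat_natCast, faceCount, Set.ncard_eq_toFinset_card', Set.toFinset_card]
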